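/- Let $p$ be a prime, $n\ge 1$, $a>0$, $\alpha>0$, $0\le\lambda<\alpha$ and $T>0$. Let $\|x\|_p=\max_i|x_i|_p$ on $\mathbb{Q}_p^n$, let $d^nx$ be the Haar measure on $\mathbb{Q}_p^n$ with $\int_{\mathbb{Z}_p^n}d^nx=1$, and let $\Psi(x)=e^{2\pi i\{x\}_p}$ be the standard additive character of $\mathbb{Q}_p$, where $\{x\}_p$ is the $p$-adic fractional part. Put $$Z(x,t)=\int_{\mathbb{Q}_p^n}\Psi(x\cdot\xi)\,e^{-at\|\xi\|_p^\alpha}\,d^n\xi\qquad(t>0),$$ and let the Taibleson operator act by $$(D_T^\alpha\varphi)(x)=\frac{1-p^{\alpha}}{1-p^{-\alpha-n}}\int_{\mathbb{Q}_p^n}\|y\|_p^{-\alpha-n}\,(\varphi(x-y)-\varphi(x))\,d^ny$$ whenever the integral converges absolutely. Let $\mathfrak{M}_\lambda$ be the set of locally constant functions $\varphi:\mathbb{Q}_p^n\to\mathbb{C}$ such that $|\varphi(x)|\le C(1+\|x\|_p^\lambda)$ for some constant $C$. A function $g(x,t)$ is in $\mathfrak{M}_\lambda$ uniformly with respect to $t$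 if $|g(x,t)|\le C(1+\|x\|_p^\lambda)$ with $C$ independent of $t$ and if for every $x$ there is an integer $l(x)$, independent of $t$, such that $g(x+y,t)=g(x,t)$ whenever $\|y\|_p\le p^{l(x)}$. Let $\varphi\in\mathfrak{M}_\lambda$, and let $f(x,t)$ be continuous on $\mathbb{Q}_p^n\times(0,T]$ and in $\mathfrak{M}_\lambda$ uniformly with respect to $t\in(0,T]$. Then the Cauchy problem $$\frac{\partial u}{\partial t}(x,t)+a(D_T^\alpha u)(x,t)=f(x,t),\quad x\in\mathbb{Q}_p^n,\ t\in(0,T],\qquad u(x,0)=\varphi(x),$$ has a solution $u$ that is continuous on $\mathbb{Q}_p^n\times[0,T]$ and in $\mathfrak{M}_\lambda$ uniformly with respect to $t\in[0,T]$ (the integral defining $D_T^\alpha u$ converges absolutely, and the $t$-derivative at $t=T$ is one-sided). For $t\in(0,T]$ it is given, with absolutely convergent integrals, by $$u(x,t)=\int_{\mathbb{Q}_p^n}Z(x-\xi,t)\varphi(\xi)\,d^n\xi+\int_0^t\left(\int_{\mathbb{Q}_p^n}Z(x-\xi,t-\tau)f(\xi,\tau)\,d^n\xi\right)d\tau .$$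 Moreover, if $\varphi$ and all $f(\cdot,t)$, $t\in(0,T]$, are invariant under translation by every $y$ with $\|y\|_p\le p^{l}$ for a fixed integer $l$, then so are all $u(\cdot,t)$, $t\in[0,T]$. -/

import Mathlib

open MeasureTheory Set

namespace PadicHeat

noncomputable section

/-- The Borel sigma-algebra on `ℚ_[p]`. -/
instance instMeasurableSpacePadic (p : ℕ) [Fact p.Prime] : MeasurableSpace ℚ_[p] :=
  borel ℚ_[p]

instance instBorelSpacePadic (p : ℕ) [Fact p.Prime] : BorelSpace ℚ_[p] := ⟨rfl⟩

/-- The closed unit ball `ℤ_p` of `ℚ_[p]`, a compact set with non-empty interior. -/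
def unitBall (p : ℕ) [Fact p.Prime] : TopologicalSpace.PositiveCompacts ℚ_[p] where
  carrier := Metric.closedBall 0 1
  isCompact' := isCompact_closedBall 0 1
  interior_nonempty' :=
    ⟨0, Metric.ball_subset_interior_closedBall (Metric.mem_ball_self one_pos)⟩

/-- The Haar measure on `ℚ_[p]` that gives `ℤ_p` the measure `1`.  The measure `volume` on
`Fin n → ℚ_[p]` is then the product measure, that is, the Haar measure `d^n x` that gives the
closed unit ball the measure `1`. -/
instance instMeasureSpacePadic (p : ℕ) [Fact p.Prime] : MeasureSpace ℚ_[p] where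
  volume := Measure.addHaarMeasure (unitBall p)

theorem norm_mul_pow_le_one {p : ℕ} [Fact p.Prime] (x : ℚ_[p]) :
    ‖x * (p : ℚ_[p]) ^ (-x.valuation).toNat‖ ≤ 1 := by
  rcases eq_or_ne x 0 with rfl | hx
  · simp
  · have hp : (1 : ℝ) < p := by exact_mod_cast (Fact.out : p.Prime).one_lt
    rw [norm_mul, norm_pow, Padic.norm_p, Padic.norm_eq_zpow_neg_valuation hx, inv_pow,
      ← zpow_natCast, ← zpow_neg, ← zpow_add₀ (by positivity)]
    apply zpow_le_one_of_nonpos₀ hp.le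
    have := Int.self_le_toNat (-x.valuation)
    linarith

/-- The `p`-adic integer `p ^ m * x`, where `m = max (-ord x) 0`. -/
def clearDenom {p : ℕ} [Fact p.Prime] (x : ℚ_[p]) : ℤ_[p] :=
  ⟨x * (p : ℚ_[p]) ^ (-x.valuation).toNat, norm_mul_pow_le_one x⟩

/-- The fractional part of a `p`-adic number: with `m = max (-ord x) 0`, it is
`p ^ (-m) * ∑_{j < m} x_j p ^ j`, where `∑_j x_j p ^ j` is the `p`-adic expansion of
`p ^ m * x ∈ ℤ_p` with digits in `{0, …, p - 1}` (`PadicInt.appr z m` is the sum of the first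
`m` terms of the expansion of `z`).  It is `0` if `x = 0` or `ord x ≥ 0`. -/
def fracPart {p : ℕ} [Fact p.Prime] (x : ℚ_[p]) : ℚ :=
  ((clearDenom x).appr (-x.valuation).toNat : ℚ) / (p : ℚ) ^ (-x.valuation).toNat

/-- The standard additive character `Ψ(x) = exp(2πi {x}_p)` of `ℚ_[p]`. -/
def stdChar {p : ℕ} [Fact p.Prime] (x : ℚ_[p]) : ℂ :=
  Complex.exp (2 * Real.pi * Complex.I * (fracPart x : ℂ))

/-- The fundamental solution
`Z(x, t) = ∫ Ψ(x · ξ) exp(-a t ‖ξ‖ ^ α) d^n ξ` (meaningful for `t > 0`); the norm of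
`Fin n → ℚ_[p]` is the maximum norm `‖ξ‖_p`. -/
def heatKernel {p : ℕ} [Fact p.Prime] {n : ℕ} (a α : ℝ) (x : Fin n → ℚ_[p]) (t : ℝ) : ℂ :=
  ∫ ξ : Fin n → ℚ_[p],
    stdChar (∑ i, x i * ξ i) * ((Real.exp (-(a * t * ‖ξ‖ ^ α)) : ℝ) : ℂ)

/-- The integrand of the Taibleson operator: `‖y‖ ^ (-α-n) (φ(x - y) - φ(x))`. -/
def taiblesonIntegrand {p : ℕ} [Fact p.Prime] {n : ℕ} (α : ℝ) (φ : (Fin n → ℚ_[p]) → ℂ)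
    (x y : Fin n → ℚ_[p]) : ℂ :=
  ((‖y‖ ^ (-α - (n : ℝ)) : ℝ) : ℂ) * (φ (x - y) - φ x)

/-- The Taibleson operator
`(D_T^α φ)(x) = (1 - p^α) / (1 - p^(-α-n)) ∫ ‖y‖ ^ (-α-n) (φ(x - y) - φ(x)) d^n y`,
in the form in which it acts on functions that need be neither bounded nor integrable. -/
def taibleson {p : ℕ} [Fact p.Prime] {n : ℕ} (α : ℝ) (φ : (Fin n → ℚ_[p]) → ℂ)
    (x : Fin n → ℚ_[p]) : ℂ :=
  (((1 - (p : ℝ) ^ α) / (1 - (p : ℝ) ^ (-α - (n : ℝ))) : ℝ) : ℂ) *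
    ∫ y : Fin n → ℚ_[p], taiblesonIntegrand α φ x y

/-- The space `𝔐_λ`: locally constant functions with `|φ(x)| ≤ C (1 + ‖x‖ ^ λ)`. -/
def MemM {p : ℕ} [Fact p.Prime] {n : ℕ} (lam : ℝ) (φ : (Fin n → ℚ_[p]) → ℂ) : Prop :=
  IsLocallyConstant φ ∧ ∃ C : ℝ, ∀ x, ‖φ x‖ ≤ C * (1 + ‖x‖ ^ lam)

/-- `φ` is constant on the ball with centre `x` and radius `p ^ l`. -/
def ConstAt {p : ℕ} [Fact p.Prime] {n : ℕ} (l : ℤ) (φ : (Fin n → ℚ_[p]) → ℂ)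
    (x : Fin n → ℚ_[p]) : Prop :=
  ∀ y : Fin n → ℚ_[p], ‖y‖ ≤ (p : ℝ) ^ l → φ (x + y) = φ x

/-- `g(·, t) ∈ 𝔐_λ` uniformly with respect to `t ∈ S`: neither the constant `C` of the growth
bound nor the exponents `l(x)` of local constancy depend on `t`. -/
def UniformMemM {p : ℕ} [Fact p.Prime] {n : ℕ} (lam : ℝ) (S : Set ℝ)
    (g : (Fin n → ℚ_[p]) → ℝ → ℂ) : Prop :=
  (∀ x, ∃ l : ℤ, ∀ t ∈ S, ConstAt l (fun z => g z t) x) ∧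
    ∃ C : ℝ, ∀ t ∈ S, ∀ x, ‖g x t‖ ≤ C * (1 + ‖x‖ ^ lam)

/-- `u` solves `∂u/∂t + a D_T^α u = f` on `ℚ_p^n × (0, T]`, `u(x, 0) = φ(x)`: the integral that
defines `D_T^α u` converges, the derivative exists (one-sided at `t = T`), and the equations
hold. -/
def IsCauchySolution {p : ℕ} [Fact p.Prime] {n : ℕ} (a α T : ℝ)
    (f : (Fin n → ℚ_[p]) → ℝ → ℂ) (φ : (Fin n → ℚ_[p]) → ℂ)
    (u : (Fin n → ℚ_[p]) → ℝ → ℂ) : Prop :=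
  (∀ x, ∀ t ∈ Ioc 0 T,
    Integrable (taiblesonIntegrand α (fun z => u z t) x) ∧
    ∃ v : ℂ, HasDerivWithinAt (fun s => u x s) v (Icc 0 T) t ∧
      v + (a : ℂ) * taibleson α (fun z => u z t) x = f x t) ∧
  ∀ x, u x 0 = φ x

end

end PadicHeat

/-
Write `A_j g` for the average of `g` over balls of radius `p ^ j`. A locally constant `g` with
`|g(x)| ≤ C (1 + ‖x‖ ^ λ)` differs from `A_j g` by the sum of the components
`A_i g - A_{i + 1} g`, `i < j`, only finitely many of which are nonzero at a given point. The `i`-th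
component lies in the eigenspace of `D_T^α` with eigenvalue `p ^ (-α i)`, and grows at most like
`p ^ (λ i)` in `i`; so `λ < α` is exactly what makes the series of components, weighted with their
eigenvalues, converge.

A kernel that is constant on spheres is a series of indicator functions of balls. Integrals against
`‖y‖ ^ (-α - n)` and `Z(y, t)` are therefore series of ball averages, and summation by parts turns
them into series over the components. In this form `D_T^α` and the heat semigroup act diagonally,
with `exp(-a p ^ (-α i) t)` in the case of the semigroup; the Cauchy problem reduces to one linear
ordinary differential equation for each component, solved by Duhamel's formula, and the series of
the solutions is differentiated term by term. The average over a ball of a function whose exponents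
of local constancy are independent of `t` is a finite sum whose terms do not depend on `t`, and so
commutes with derivatives, integrals and series.
-/

namespace PadicHeat

open Filter Topology

noncomputable section

variable {p : ℕ} [Fact p.Prime] {n : ℕ}

section IntegerSeries

theorem hasSum_indicator_Ioi_sub {F : ℤ → ℝ} {B : ℝ} (hF : Monotone F)
    (hB : Tendsto F atTop (𝓝 B)) (m : ℤ) :
    HasSum ((Ioi m).indicator fun j => F j - F (j - 1)) (B - F m) := by
  have hinj : Function.Injective fun k : ℕ => m + 1 + k := fun a b h => by simpa using h
  have hlim : Tendsto (fun k : ℕ => F (m + k)) atTop (𝓝 B) :=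
    hB.comp (tendsto_atTop_add_const_left _ _ tendsto_natCast_atTop_atTop)
  rw [← hinj.hasSum_iff, hasSum_iff_tendsto_nat_of_nonneg]
  · refine (hlim.sub_const (F m)).congr fun N => ?_
    induction N with
    | zero => simp
    | succ N ih =>
      rw [Finset.sum_range_succ, ← ih, Function.comp_apply, indicator_of_mem (by simp; lia)]
      push_cast
      ring_nf
  · exact fun k => indicator_nonneg (fun j _ => sub_nonneg.2 (hF (by lia))) _
  · exact fun j hj => indicator_of_notMem (fun h => hj ⟨(j - (m + 1)).toNat, by
      simp only [mem_Ioi] at h; simp only; lia⟩) _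

theorem hasSum_indicator_Iic_sub {F : ℤ → ℝ} {A : ℝ} (hF : Monotone F)
    (hA : Tendsto F atBot (𝓝 A)) (m : ℤ) :
    HasSum ((Iic m).indicator fun j => F j - F (j - 1)) (F m - A) := by
  have h := hasSum_indicator_Ioi_sub (F := fun j => -F (-j)) (B := -A)
    (fun i j hij => neg_le_neg (hF (neg_le_neg hij))) (hA.comp tendsto_neg_atTop_atBot).neg (-m)
  rw [← (Equiv.subLeft (1 : ℤ)).hasSum_iff]
  convert h using 1
  · funext j
    simp only [Function.comp_apply, Equiv.subLeft_apply, indicator_apply, mem_Iic, mem_Ioi,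
      show 1 - j ≤ m ↔ -m < j by lia, show -(j - 1) = 1 - j by ring,
      show 1 - j - 1 = -j by ring, neg_sub_neg]
  · simp only [neg_neg]
    ring

theorem hasSum_int_sub {F : ℤ → ℝ} {A B : ℝ} (hF : Monotone F) (hA : Tendsto F atBot (𝓝 A))
    (hB : Tendsto F atTop (𝓝 B)) : HasSum (fun j => F j - F (j - 1)) (B - A) := by
  convert (hasSum_indicator_Iic_sub hF hA 0).add (hasSum_indicator_Ioi_sub hF hB 0) using 1
  · rw [← compl_Iic]
    exact (indicator_self_add_compl _ _).symm
  · ring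

theorem summable_indicator_Ioi_zpow {r : ℝ} (h0 : 0 < r) (h1 : r < 1) (m : ℤ) :
    Summable ((Ioi m).indicator fun j : ℤ => r ^ j) := by
  have hinj : Function.Injective fun k : ℕ => m + 1 + k := fun a b h => by simpa using h
  rw [← hinj.summable_iff fun j hj => indicator_of_notMem (fun h => hj ⟨(j - (m + 1)).toNat, by
      simp only [mem_Ioi] at h; simp only; lia⟩) _]
  refine ((summable_geometric_of_lt_one h0.le h1).mul_left (r ^ (m + 1))).congr fun k => ?_
  rw [Function.comp_apply, indicator_of_mem (by simp; lia), zpow_add₀ h0.ne' (m + 1),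
    zpow_natCast]

theorem tendsto_zpow_atTop_zero {r : ℝ} (h0 : 0 < r) (h1 : r < 1) :
    Tendsto (fun j : ℤ => r ^ j) atTop (𝓝 0) := by
  refine ((summable_indicator_Ioi_zpow h0 h1 0).tendsto_cofinite_zero.mono_left ?_).congr' ?_
  · rw [Int.cofinite_eq]
    exact le_sup_right
  · exact (eventually_gt_atTop 0).mono fun j hj => indicator_of_mem (mem_Ioi.2 hj) _

/-- Summation by parts over `ℤ`: both sides are iterated sums of the double series with terms
`(F j - F (j - 1)) • d i` for `i < j`. -/
theorem hasSum_sub_smul_sum_Ico {E : Type*} [NormedAddCommGroup E] [NormedSpace ℝ E]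
    [CompleteSpace E] {F : ℤ → ℝ} {B : ℝ} {d : ℤ → E} {l : ℤ} (hF : Monotone F)
    (hB : Tendsto F atTop (𝓝 B)) (hd : ∀ i < l, d i = 0)
    (hs : Summable fun i => (B - F i) * ‖d i‖) :
    HasSum (fun j => (F j - F (j - 1)) • ∑ i ∈ Finset.Ico l j, d i)
      (∑' i, (B - F i) • d i) := by
  set c : ℤ → ℤ → ℝ := fun i => (Ioi i).indicator fun j => F j - F (j - 1) with hc
  have hc0 : ∀ i j, 0 ≤ c i j := fun i => indicator_nonneg fun j _ => sub_nonneg.2 (hF (by lia))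
  have hrow : ∀ i, HasSum (c i) (B - F i) := hasSum_indicator_Ioi_sub hF hB
  have hsum : Summable fun q : ℤ × ℤ => c q.1 q.2 • d q.1 := by
    refine .of_norm ?_
    simp only [norm_smul, Real.norm_of_nonneg (hc0 _ _)]
    refine (summable_prod_of_nonneg fun q => mul_nonneg (hc0 _ _) (norm_nonneg _)).2 ⟨?_, ?_⟩
    · exact fun i => (hrow i).summable.mul_right ‖d i‖
    · simpa only [((hrow _).mul_right ‖d _‖).tsum_eq] using hs
  have htot : ∑' q : ℤ × ℤ, c q.1 q.2 • d q.1 = ∑' i, (B - F i) • d i := by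
    rw [hsum.tsum_prod]
    exact tsum_congr fun i => ((hrow i).smul_const (d i)).tsum_eq
  rw [← htot]
  refine ((Equiv.prodComm ℤ ℤ).hasSum_iff.2 hsum.hasSum).prod_fiberwise fun j => ?_
  simp only [Function.comp_apply, Equiv.prodComm_apply, Prod.fst_swap, Prod.snd_swap]
  have hcol : ∑ i ∈ Finset.Ico l j, c i j • d i =
      (F j - F (j - 1)) • ∑ i ∈ Finset.Ico l j, d i := by
    rw [Finset.smul_sum]
    refine Finset.sum_congr rfl fun i hi => ?_
    simp only [hc, indicator_of_mem (mem_Ioi.2 (Finset.mem_Ico.1 hi).2)]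
  rw [← hcol]
  refine hasSum_sum_of_ne_finset_zero fun i hi => ?_
  rcases lt_or_ge i l with hil | hli
  · simp [hd i hil]
  · have hij : j ∉ Ioi i := fun h => hi (Finset.mem_Ico.2 ⟨hli, h⟩)
    simp [hc, indicator_of_notMem hij]

end IntegerSeries

section Integration

theorem integrable_of_hasSum {β ι E : Type*} [MeasurableSpace β] {μ : Measure β} [Countable ι]
    [NormedAddCommGroup E] {F : ι → β → E} {f : β → E} (hF : ∀ i, Integrable (F i) μ)
    (hs : Summable fun i => ∫ x, ‖F i x‖ ∂μ) (hf : ∀ x, HasSum (fun i => F i x) (f x)) :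
    Integrable f μ := by
  refine ⟨aestronglyMeasurable_of_tendsto_ae (u := (atTop : Filter (Finset ι)))
    (f := fun s x => ∑ i ∈ s, F i x)
    (fun s => Finset.aestronglyMeasurable_fun_sum s fun i _ => (hF i).1) (ae_of_all _ hf), ?_⟩
  calc ∫⁻ x, ‖f x‖ₑ ∂μ ≤ ∫⁻ x, ∑' i, ‖F i x‖ₑ ∂μ :=
        lintegral_mono fun x => (hf x).tsum_eq ▸ enorm_tsum_le_tsum_enorm
    _ = ∑' i, ENNReal.ofReal (∫ x, ‖F i x‖ ∂μ) := by
        rw [lintegral_tsum fun i => (hF i).1.enorm]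
        exact tsum_congr fun i => (ofReal_integral_norm_eq_lintegral_enorm (hF i)).symm
    _ < ⊤ := by
        rw [← ENNReal.ofReal_tsum_of_nonneg (fun i => by positivity) hs]
        exact ENNReal.ofReal_lt_top

theorem integral_eq_zero_of_add_left_eq_mul {G : Type*} [AddGroup G] [MeasurableSpace G]
    [MeasurableAdd G] {μ : Measure G} [μ.IsAddLeftInvariant] {f : G → ℂ} {c : ℂ} {g : G}
    (hc : c ≠ 1) (hf : ∀ x, f (g + x) = c * f x) : ∫ x, f x ∂μ = 0 := by
  have h : ∫ x, f x ∂μ = c * ∫ x, f x ∂μ := by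
    simpa only [hf, integral_const_mul] using (integral_add_left_eq_self f g).symm
  exact (mul_eq_zero.1 (by linear_combination h : (1 - c) * ∫ x, f x ∂μ = 0)).resolve_left
    (sub_ne_zero.2 hc.symm)

theorem integrable_and_hasSum_integral_mul_of_hasSum_indicator {β ι : Type*} [MeasurableSpace β]
    {μ : Measure β} [Countable ι] {s : ι → Set β} {κ b : ι → ℝ} {h K : β → ℂ}
    (hs : ∀ i, MeasurableSet (s i)) (hμ : ∀ i, μ (s i) ≠ ⊤) (hκ : ∀ i, 0 ≤ κ i)
    (hh : AEStronglyMeasurable h μ) (hb : ∀ i, ∀ y ∈ s i, ‖h y‖ ≤ b i)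
    (hsum : Summable fun i => κ i * μ.real (s i) * b i)
    (hK : ∀ y, h y ≠ 0 → HasSum (fun i => (s i).indicator (fun _ => (κ i : ℂ)) y) (K y)) :
    Integrable (fun y => K y * h y) μ ∧
      HasSum (fun i => (κ i * μ.real (s i)) • ⨍ y in s i, h y ∂μ) (∫ y, K y * h y ∂μ) := by
  set F : ι → β → ℂ := fun i => (s i).indicator fun y => κ i * h y with hF
  have hFK : ∀ y, HasSum (fun i => F i y) (K y * h y) := fun y => by
    rcases eq_or_ne (h y) 0 with hy | hy
    · simpa only [hF, indicator_mul_left, hy, mul_zero] using hasSum_zero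
    · simpa only [hF, indicator_mul_left] using (hK y hy).mul_right (h y)
  have hbi : ∀ i, ∀ y ∈ s i, ‖κ i * h y‖ ≤ κ i * b i := fun i y hy => by
    rw [norm_mul, Complex.norm_of_nonneg (hκ i)]
    exact mul_le_mul_of_nonneg_left (hb i y hy) (hκ i)
  have hFi : ∀ i, Integrable (F i) μ := fun i =>
    (integrable_indicator_iff (hs i)).2 <| .of_bound (hμ i).lt_top
      (hh.restrict.const_mul _) _ (ae_restrict_of_forall_mem (hs i) (hbi i))
  have hFs : Summable fun i => ∫ y, ‖F i y‖ ∂μ := by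
    refine hsum.of_nonneg_of_le (fun i => by positivity) fun i => ?_
    simp only [hF, norm_indicator_eq_indicator_norm]
    rw [integral_indicator (hs i)]
    refine (le_abs_self _).trans ((norm_setIntegral_le_of_norm_le_const (hμ i).lt_top
      fun y hy => (norm_norm _).trans_le (hbi i y hy)).trans_eq (by ring))
  have hFint : ∀ i, ∫ y, F i y ∂μ = (κ i * μ.real (s i)) • ⨍ y in s i, h y ∂μ := fun i => by
    rw [integral_indicator (hs i), integral_const_mul, mul_smul,
      measure_smul_setAverage _ (hμ i), Complex.real_smul]
  refine ⟨integrable_of_hasSum hFi hFs hFK, ?_⟩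
  have h := hasSum_integral_of_summable_integral_norm hFi hFs
  simpa only [hFint, (hFK _).tsum_eq] using h

end Integration

section Balls

variable (p) in
theorem one_lt_prime_cast : (1 : ℝ) < p := mod_cast (Fact.out : p.Prime).one_lt

variable (p) in
theorem prime_cast_pos : (0 : ℝ) < p := zero_lt_one.trans (one_lt_prime_cast p)

instance : (volume : Measure ℚ_[p]).IsAddHaarMeasure :=
  inferInstanceAs (Measure.addHaarMeasure (unitBall p)).IsAddHaarMeasure

theorem existsUnique_norm_sub_natCast_lt_one {z : ℚ_[p]} (hz : ‖z‖ ≤ 1) :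
    ∃! i : Fin p, ‖z - (i : ℕ)‖ < 1 := by
  obtain ⟨i, ⟨hip, hi⟩, huniq⟩ := PadicInt.existsUnique_mem_range (p := p) ⟨z, hz⟩
  simp only [PadicInt.maximalIdeal_eq_span_p, Ideal.mem_span_singleton,
    ← PadicInt.norm_lt_one_iff_dvd] at hi huniq
  exact ⟨⟨i, hip⟩, hi, fun j hj => Fin.ext (huniq j ⟨j.2, hj⟩)⟩

theorem norm_sub_mul_zpow_le_iff (x y : ℚ_[p]) (k : ℤ) :
    ‖x - y * (p : ℚ_[p]) ^ (-(k + 1))‖ ≤ (p : ℝ) ^ k ↔ ‖x * (p : ℚ_[p]) ^ (k + 1) - y‖ < 1 := by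
  have hp0 : (p : ℚ_[p]) ≠ 0 := mod_cast (Fact.out : p.Prime).ne_zero
  have hscale : x * (p : ℚ_[p]) ^ (k + 1) - y =
      (x - y * (p : ℚ_[p]) ^ (-(k + 1))) * (p : ℚ_[p]) ^ (k + 1) := by
    rw [sub_mul, mul_assoc, ← zpow_add₀ hp0, neg_add_cancel, zpow_zero, mul_one]
  rw [hscale, norm_mul, Padic.norm_p_zpow, Padic.norm_le_pow_iff_norm_lt_pow_add_one,
    zpow_neg (p : ℝ), mul_inv_lt_iff₀ (zpow_pos (prime_cast_pos p) _), one_mul]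

theorem norm_mul_zpow_le_one_iff (x : ℚ_[p]) (k : ℤ) :
    ‖x * (p : ℚ_[p]) ^ k‖ ≤ 1 ↔ ‖x‖ ≤ (p : ℝ) ^ k := by
  rw [norm_mul, Padic.norm_p_zpow, zpow_neg, mul_inv_le_iff₀ (zpow_pos (prime_cast_pos p) _),
    one_mul]

theorem closedBall_zpow_add_one (k : ℤ) :
    Metric.closedBall (0 : ℚ_[p]) ((p : ℝ) ^ (k + 1)) =
      ⋃ i : Fin p, Metric.closedBall ((i : ℕ) * (p : ℚ_[p]) ^ (-(k + 1))) ((p : ℝ) ^ k) := by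
  ext x
  rw [mem_closedBall_zero_iff, ← norm_mul_zpow_le_one_iff]
  simp only [mem_iUnion, Metric.mem_closedBall, dist_eq_norm, norm_sub_mul_zpow_le_iff]
  refine ⟨fun h => (existsUnique_norm_sub_natCast_lt_one h).exists, fun ⟨i, hi⟩ => ?_⟩
  rw [← sub_add_cancel (x * _) ((i : ℕ) : ℚ_[p])]
  exact (IsUltrametricDist.norm_add_le_max _ _).trans
    (max_le hi.le (mod_cast Padic.norm_int_le_one (i : ℤ)))

theorem pairwise_disjoint_closedBall_zpow (k : ℤ) : Pairwise (Function.onFun Disjoint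
    fun i : Fin p => Metric.closedBall ((i : ℕ) * (p : ℚ_[p]) ^ (-(k + 1))) ((p : ℝ) ^ k)) := by
  refine fun i j hij => disjoint_left.2 fun x hi hj => hij ?_
  have hx : x ∈ Metric.closedBall (0 : ℚ_[p]) ((p : ℝ) ^ (k + 1)) := by
    rw [closedBall_zpow_add_one]
    exact mem_iUnion_of_mem i hi
  rw [mem_closedBall_zero_iff, ← norm_mul_zpow_le_one_iff] at hx
  rw [Metric.mem_closedBall, dist_eq_norm, norm_sub_mul_zpow_le_iff] at hi hj
  exact (existsUnique_norm_sub_natCast_lt_one hx).unique hi hj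

theorem measureReal_closedBall_zpow (k : ℤ) :
    volume.real (Metric.closedBall (0 : ℚ_[p]) ((p : ℝ) ^ k)) = (p : ℝ) ^ k := by
  have hp := prime_cast_pos p
  have hsucc (k : ℤ) : volume.real (Metric.closedBall (0 : ℚ_[p]) ((p : ℝ) ^ (k + 1))) =
      p * volume.real (Metric.closedBall (0 : ℚ_[p]) ((p : ℝ) ^ k)) := by
    rw [measureReal_def, closedBall_zpow_add_one,
      measure_iUnion (pairwise_disjoint_closedBall_zpow k)
        fun i => Metric.isClosed_closedBall.measurableSet]
    simp [Measure.addHaar_closedBall_center volume (_ * _), measureReal_def]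
  induction k using Int.induction_on with
  | zero =>
    rw [zpow_zero, measureReal_def]
    exact congrArg ENNReal.toReal (Measure.addHaarMeasure_self (K₀ := unitBall p))
  | succ k ih => rw [hsucc, ih, zpow_add_one₀ hp.ne', mul_comm]
  | pred k ih =>
    rw [← mul_right_inj' hp.ne', ← hsucc, sub_add_cancel, ih, zpow_sub_one₀ hp.ne',
      mul_left_comm, mul_inv_cancel₀ hp.ne', mul_one]

variable (p n) in
/-- The closed ball of radius `p ^ j` about the origin of `ℚ_p ^ n`, which is an open subgroup
because the norm is ultrametric. -/
def padicBall (j : ℤ) : OpenAddSubgroup (Fin n → ℚ_[p]) :=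
  IsUltrametricDist.closedBall_openAddSubgroup _ (zpow_pos (prime_cast_pos p) j)

theorem mem_padicBall {j : ℤ} {y : Fin n → ℚ_[p]} : y ∈ padicBall p n j ↔ ‖y‖ ≤ (p : ℝ) ^ j :=
  mem_closedBall_zero_iff

theorem coe_padicBall (j : ℤ) :
    (padicBall p n j : Set (Fin n → ℚ_[p])) = Metric.closedBall 0 ((p : ℝ) ^ j) := rfl

theorem isCompact_padicBall (j : ℤ) : IsCompact (padicBall p n j : Set (Fin n → ℚ_[p])) :=
  isCompact_closedBall _ _

theorem measurableSet_padicBall (j : ℤ) :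
    MeasurableSet (padicBall p n j : Set (Fin n → ℚ_[p])) :=
  (padicBall p n j).isClosed.measurableSet

theorem padicBall_mono : Monotone (padicBall p n) := fun _ _ h _ hy =>
  mem_padicBall.2 ((mem_padicBall.1 hy).trans (zpow_le_zpow_right₀ (one_lt_prime_cast p).le h))

theorem measureReal_padicBall (j : ℤ) :
    volume.real (padicBall p n j : Set (Fin n → ℚ_[p])) = ((p : ℝ) ^ n) ^ j := by
  have hp := prime_cast_pos p
  rw [measureReal_def, coe_padicBall, closedBall_pi _ (by positivity), volume_pi_pi,
    ENNReal.toReal_prod]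
  simp only [Pi.zero_apply, ← measureReal_def, measureReal_closedBall_zpow, Finset.prod_const,
    Finset.card_univ, Fintype.card_fin]
  rw [← zpow_natCast, ← zpow_natCast, zpow_comm]

theorem exists_norm_eq_zpow {y : Fin n → ℚ_[p]} (hy : y ≠ 0) : ∃ m : ℤ, ‖y‖ = (p : ℝ) ^ m := by
  obtain ⟨i₀, -⟩ := Function.ne_iff.1 hy
  have : Nonempty (Fin n) := ⟨i₀⟩
  obtain ⟨i, hi⟩ := Finite.exists_max fun i => ‖y i‖
  have h : ‖y‖ = ‖y i‖ :=
    le_antisymm ((pi_norm_le_iff_of_nonneg (norm_nonneg _)).2 hi) (norm_le_pi_norm y i)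
  exact ⟨_, h.trans (Padic.norm_eq_zpow_neg_valuation
    (norm_ne_zero_iff.1 (h ▸ norm_ne_zero_iff.2 hy)))⟩

theorem mem_padicBall_iff_le {m j : ℤ} {y : Fin n → ℚ_[p]} (hy : ‖y‖ = (p : ℝ) ^ m) :
    y ∈ padicBall p n j ↔ m ≤ j := by
  rw [mem_padicBall, hy, zpow_le_zpow_iff_right₀ (one_lt_prime_cast p)]

end Balls

section Character

theorem norm_sub_fracPart_le_one (x : ℚ_[p]) : ‖x - (fracPart x : ℚ_[p])‖ ≤ 1 := by
  have hp := prime_cast_pos p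
  have hp0 : (p : ℚ_[p]) ≠ 0 := mod_cast (Fact.out : p.Prime).ne_zero
  set m := (-x.valuation).toNat with hm
  have happr : ‖x * (p : ℚ_[p]) ^ m - ((clearDenom x).appr m : ℚ_[p])‖ ≤
      (p : ℝ) ^ (-(m : ℤ)) := by
    have h := PadicInt.appr_spec m (clearDenom x)
    rwa [← PadicInt.norm_le_pow_iff_mem_span_pow, PadicInt.norm_def, PadicInt.coe_sub,
      PadicInt.coe_natCast] at h
  have hscale : x - (fracPart x : ℚ_[p]) =
      (x * (p : ℚ_[p]) ^ m - ((clearDenom x).appr m : ℚ_[p])) * ((p : ℚ_[p]) ^ m)⁻¹ := by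
    rw [fracPart, ← hm]
    push_cast
    field_simp
  rw [hscale, norm_mul, norm_inv, norm_pow, Padic.norm_p, inv_pow, inv_inv]
  exact (mul_le_mul_of_nonneg_right happr (by positivity)).trans_eq
    (by rw [zpow_neg, zpow_natCast, inv_mul_cancel₀ (by positivity)])

theorem exists_intCast_eq_of_norm_le_one {q : ℚ} {N : ℤ} {M : ℕ} (hq : q = N / (p : ℚ) ^ M)
    (h : ‖(q : ℚ_[p])‖ ≤ 1) : ∃ k : ℤ, q = k := by
  have hp := prime_cast_pos p
  have hp0 : (p : ℚ) ≠ 0 := mod_cast (Fact.out : p.Prime).ne_zero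
  have hN : (N : ℚ) = q * (p : ℚ) ^ M := by rw [hq, div_mul_cancel₀ _ (pow_ne_zero _ hp0)]
  obtain ⟨k, hk⟩ : (p ^ M : ℤ) ∣ N := by
    rw [← Padic.norm_int_le_pow_iff_dvd]
    have hNp : (N : ℚ_[p]) = (q : ℚ_[p]) * (p : ℚ_[p]) ^ M := by
      exact_mod_cast congrArg (Rat.cast : ℚ → ℚ_[p]) hN
    rw [hNp, norm_mul, norm_pow, Padic.norm_p, inv_pow, zpow_neg, zpow_natCast]
    exact mul_le_of_le_one_left (by positivity) h
  refine ⟨k, ?_⟩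
  rw [hq, hk]
  push_cast
  field_simp

theorem stdChar_eq_one_iff (x : ℚ_[p]) : stdChar x = 1 ↔ ‖x‖ ≤ 1 := by
  have hexp : stdChar x = 1 ↔ ∃ k : ℤ, fracPart x = k := by
    rw [stdChar, Complex.exp_eq_one_iff]
    refine exists_congr fun k => ?_
    rw [mul_comm (k : ℂ), mul_right_inj' Complex.two_pi_I_ne_zero]
    exact_mod_cast Iff.rfl
  have hs := norm_sub_fracPart_le_one x
  rw [hexp]
  refine ⟨fun ⟨k, hk⟩ => ?_, fun hx => ?_⟩
  · simpa [hk] using (PadicInt.subring p).add_mem hs (Padic.norm_int_le_one k)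
  · refine exists_intCast_eq_of_norm_le_one (p := p) (N := (clearDenom x).appr _)
      (by rw [fracPart, Int.cast_natCast]) ?_
    simpa using (PadicInt.subring p).sub_mem hx hs

theorem stdChar_add (x y : ℚ_[p]) : stdChar (x + y) = stdChar x * stdChar y := by
  have hp0 : (p : ℚ) ≠ 0 := mod_cast (Fact.out : p.Prime).ne_zero
  have hcocycle : ∃ k : ℤ, fracPart x + fracPart y - fracPart (x + y) = k := by
    have hrepr (z : ℚ_[p]) : ∃ N M : ℕ, fracPart z = (N : ℚ) / (p : ℚ) ^ M := ⟨_, _, rfl⟩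
    obtain ⟨N₁, M₁, h₁⟩ := hrepr x
    obtain ⟨N₂, M₂, h₂⟩ := hrepr y
    obtain ⟨N₃, M₃, h₃⟩ := hrepr (x + y)
    refine exists_intCast_eq_of_norm_le_one (p := p) (M := M₁ + M₂ + M₃)
      (N := N₁ * p ^ (M₂ + M₃) + N₂ * p ^ (M₁ + M₃) - N₃ * p ^ (M₁ + M₂)) ?_ ?_
    · rw [h₁, h₂, h₃]
      push_cast
      field_simp
      ring
    · have h := (PadicInt.subring p).sub_mem (norm_sub_fracPart_le_one (x + y))
        ((PadicInt.subring p).add_mem (norm_sub_fracPart_le_one x) (norm_sub_fracPart_le_one y))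
      convert (PadicInt.mem_subring_iff p).1 h using 2
      push_cast
      ring
  obtain ⟨k, hk⟩ := hcocycle
  have hsum : (fracPart x + fracPart y : ℂ) = fracPart (x + y) + k := by
    exact_mod_cast congrArg (Rat.cast : ℚ → ℂ) (sub_eq_iff_eq_add'.1 hk)
  rw [stdChar, stdChar, stdChar, ← Complex.exp_add, ← mul_add, hsum, mul_add, Complex.exp_add,
    mul_comm _ (k : ℂ), Complex.exp_int_mul_two_pi_mul_I, mul_one]

theorem norm_stdChar (x : ℚ_[p]) : ‖stdChar x‖ = 1 := by
  rw [stdChar, show 2 * Real.pi * Complex.I * (fracPart x : ℂ) =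
    ((2 * Real.pi * (fracPart x : ℝ) : ℝ) : ℂ) * Complex.I by push_cast; ring,
    Complex.norm_exp_ofReal_mul_I]

theorem continuous_stdChar : Continuous (stdChar : ℚ_[p] → ℂ) := by
  refine IsLocallyConstant.continuous ((IsLocallyConstant.iff_eventually_eq _).2 fun x => ?_)
  filter_upwards [Metric.closedBall_mem_nhds x one_pos] with y hy
  rw [Metric.mem_closedBall, dist_eq_norm, ← stdChar_eq_one_iff] at hy
  rw [← sub_add_cancel y x, stdChar_add, hy, one_mul]

theorem continuous_stdChar_sum (x : Fin n → ℚ_[p]) :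
    Continuous fun ξ : Fin n → ℚ_[p] => stdChar (∑ i, x i * ξ i) :=
  continuous_stdChar.comp (by fun_prop)

theorem norm_sum_mul_le (x ξ : Fin n → ℚ_[p]) : ‖∑ i, x i * ξ i‖ ≤ ‖x‖ * ‖ξ‖ := by
  refine IsUltrametricDist.norm_sum_le_of_forall_le_of_nonneg (by positivity) fun i _ => ?_
  rw [norm_mul]
  gcongr <;> exact norm_le_pi_norm _ i

theorem exists_mem_padicBall_neg_stdChar_ne_one {x : Fin n → ℚ_[p]} {j : ℤ}
    (hx : x ∉ padicBall p n j) : ∃ η ∈ padicBall p n (-j), stdChar (∑ i, x i * η i) ≠ 1 := by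
  have hp := prime_cast_pos p
  obtain ⟨i, hi⟩ : ∃ i, (p : ℝ) ^ j < ‖x i‖ := by
    by_contra! h
    exact hx (mem_padicBall.2 ((pi_norm_le_iff_of_nonneg (by positivity)).2 h))
  refine ⟨Pi.single i ((p : ℚ_[p]) ^ j), ?_, ?_⟩
  · rw [mem_padicBall, Pi.norm_single, Padic.norm_p_zpow]
  · rw [Ne, stdChar_eq_one_iff, not_le]
    simp only [Pi.single_apply, mul_ite, mul_zero, Finset.sum_ite_eq', Finset.mem_univ, if_true,
      norm_mul, Padic.norm_p_zpow]
    rwa [zpow_neg, ← div_eq_mul_inv, one_lt_div (by positivity)]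

theorem setIntegral_stdChar (x : Fin n → ℚ_[p]) (j : ℤ) :
    ∫ ξ in (padicBall p n (-j) : Set (Fin n → ℚ_[p])), stdChar (∑ i, x i * ξ i) =
      (padicBall p n j : Set (Fin n → ℚ_[p])).indicator
        (fun _ => ((((p : ℝ) ^ n) ^ (-j) : ℝ) : ℂ)) x := by
  have hp := prime_cast_pos p
  by_cases hx : x ∈ padicBall p n j
  · have hone : ∀ ξ ∈ padicBall p n (-j), stdChar (∑ i, x i * ξ i) = 1 := fun ξ hξ => by
      rw [mem_padicBall] at hx hξ
      refine (stdChar_eq_one_iff _).2 ((norm_sum_mul_le x ξ).trans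
        ((mul_le_mul hx hξ (norm_nonneg _) (by positivity)).trans_eq ?_))
      rw [zpow_neg, mul_inv_cancel₀ (by positivity)]
    rw [indicator_of_mem hx, setIntegral_congr_fun (measurableSet_padicBall _) hone,
      setIntegral_const, measureReal_padicBall]
    simp
  · obtain ⟨η, hη, hη1⟩ := exists_mem_padicBall_neg_stdChar_ne_one hx
    rw [indicator_of_notMem hx, ← integral_indicator (measurableSet_padicBall _)]
    refine integral_eq_zero_of_add_left_eq_mul hη1 (g := η) fun ξ => ?_
    have hmem : η + ξ ∈ (padicBall p n (-j) : Set (Fin n → ℚ_[p])) ↔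
        ξ ∈ (padicBall p n (-j) : Set (Fin n → ℚ_[p])) := add_mem_cancel_left hη
    by_cases hξ : ξ ∈ (padicBall p n (-j) : Set (Fin n → ℚ_[p]))
    · simp only [indicator_of_mem hξ, indicator_of_mem (hmem.2 hξ), Pi.add_apply, mul_add,
        Finset.sum_add_distrib, stdChar_add]
    · rw [indicator_of_notMem hξ, indicator_of_notMem (mt hmem.1 hξ), mul_zero]

end Character

section LocalConstancy

variable {l m : ℤ} {g : (Fin n → ℚ_[p]) → ℂ} {x y : Fin n → ℚ_[p]}

theorem constAt_iff : ConstAt l g x ↔ ∀ y ∈ padicBall p n l, g (x + y) = g x := by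
  simp only [ConstAt, mem_padicBall]

theorem ConstAt.mono (h : ConstAt l g x) (hml : m ≤ l) : ConstAt m g x :=
  constAt_iff.2 fun y hy => constAt_iff.1 h y (padicBall_mono hml hy)

theorem ConstAt.eq_sub (h : ConstAt l g x) (hy : y ∈ padicBall p n l) : g (x - y) = g x := by
  rw [sub_eq_add_neg]
  exact constAt_iff.1 h _ (neg_mem hy)

theorem ConstAt.translate (h : ConstAt l g x) (hy : y ∈ padicBall p n l) :
    ConstAt l g (x + y) := constAt_iff.2 fun z hz => by
  rw [add_assoc, constAt_iff.1 h _ (add_mem hy hz), constAt_iff.1 h _ hy]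

theorem ConstAt.intervalIntegral {G : ℝ → (Fin n → ℚ_[p]) → ℂ} {s t : ℝ}
    (h : ∀ τ ∈ uIoo s t, ConstAt l (G τ) x) : ConstAt l (fun z => ∫ τ in s..t, G τ z) x :=
  fun y hy => intervalIntegral.integral_congr_uIoo fun τ hτ => h τ hτ y hy

theorem eventually_sub_mem_padicBall (x : Fin n → ℚ_[p]) (l : ℤ) :
    ∀ᶠ z in 𝓝 x, z - x ∈ padicBall p n l := by
  filter_upwards [Metric.closedBall_mem_nhds x (zpow_pos (prime_cast_pos p) l)] with z hz
  rwa [mem_padicBall, ← dist_eq_norm]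

theorem isLocallyConstant_of_constAt {l : (Fin n → ℚ_[p]) → ℤ} (h : ∀ x, ConstAt (l x) g x) :
    IsLocallyConstant g := (IsLocallyConstant.iff_eventually_eq _).2 fun x => by
  filter_upwards [eventually_sub_mem_padicBall x (l x)] with z hz
  simpa using constAt_iff.1 (h x) _ hz

theorem exists_constAt_of_isLocallyConstant (h : IsLocallyConstant g) (x : Fin n → ℚ_[p]) :
    ∃ l : ℤ, ConstAt l g x := by
  obtain ⟨ε, hε, hball⟩ := Metric.eventually_nhds_iff_ball.1
    ((IsLocallyConstant.iff_eventually_eq _).1 h x)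
  obtain ⟨k, hk⟩ := ((tendsto_zpow_atTop_zero (inv_pos.2 (prime_cast_pos p))
    (inv_lt_one_of_one_lt₀ (one_lt_prime_cast p))).eventually_lt_const hε).exists
  refine ⟨-k, fun y hy => hball _ ?_⟩
  rw [mem_ball_iff_norm, add_sub_cancel_left]
  exact hy.trans_lt (by rwa [zpow_neg, ← inv_zpow])

theorem exists_forall_constAt_of_isCompact (l : (Fin n → ℚ_[p]) → ℤ) {K : Set (Fin n → ℚ_[p])}
    (hK : IsCompact K) :
    ∃ m : ℤ, ∀ g : (Fin n → ℚ_[p]) → ℂ, (∀ x, ConstAt (l x) g x) → ∀ x ∈ K, ConstAt m g x := by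
  refine hK.induction_on
    (p := fun s => ∃ m : ℤ, ∀ g : _ → ℂ, (∀ x, ConstAt (l x) g x) → ∀ x ∈ s, ConstAt m g x)
    ⟨0, fun g _ x hx => absurd hx (notMem_empty x)⟩
    (fun s t hst ⟨m, hm⟩ => ⟨m, fun g hg x hx => hm g hg x (hst hx)⟩) ?_ fun x _ =>
      ⟨_, mem_nhdsWithin_of_mem_nhds (eventually_sub_mem_padicBall x (l x)), l x,
        fun g hg z hz => by simpa using (hg x).translate hz⟩
  rintro s t ⟨m₁, h₁⟩ ⟨m₂, h₂⟩
  refine ⟨min m₁ m₂, fun g hg x hx => hx.elim (fun hs => ?_) fun ht => ?_⟩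
  · exact (h₁ g hg x hs).mono (min_le_left _ _)
  · exact (h₂ g hg x ht).mono (min_le_right _ _)

end LocalConstancy

section Quadrature

universe u

variable {G : Type u} [AddGroup G] [TopologicalSpace G] [IsTopologicalAddGroup G]
  [MeasurableSpace G] [OpensMeasurableSpace G]
  {E : Type*} [NormedAddCommGroup E] [NormedSpace ℝ E] [CompleteSpace E]

theorem exists_setIntegral_eq_sum (μ : Measure G) (U : OpenAddSubgroup G) {K : Set G}
    (hK : IsCompact K) (hKm : MeasurableSet K) (hμ : μ K ≠ ⊤) :
    ∃ (ι : Type u) (_ : Fintype ι) (c : ι → ℝ) (y : ι → G), (∀ i, y i ∈ K) ∧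
      ∀ g : G → E, (∀ y ∈ K, ∀ u ∈ U, g (y + u) = g y) →
        ∫ y in K, g y ∂μ = ∑ i, c i • g (y i) := by
  let π : G → G ⧸ U.toAddSubgroup := QuotientAddGroup.mk
  have := QuotientAddGroup.discreteTopology U.isOpen'
  have hπ : Continuous π := continuous_quotient_mk'
  have : Finite (π '' K) := (hK.image hπ).finite_of_discrete.to_subtype
  have := Fintype.ofFinite (π '' K)
  let piece (q : π '' K) : Set G := π ⁻¹' {q.1} ∩ K
  have hmeas (q : π '' K) : MeasurableSet (piece q) :=
    ((isOpen_discrete _).preimage hπ).measurableSet.inter hKm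
  have hdisj : Pairwise (Function.onFun Disjoint piece) := fun q q' hqq' =>
    disjoint_left.2 fun z hz hz' => hqq' (Subtype.ext (hz.1.symm.trans hz'.1))
  have hunion : ⋃ q, piece q = K := Subset.antisymm (iUnion_subset fun q => inter_subset_right)
    fun z hz => mem_iUnion.2 ⟨⟨π z, mem_image_of_mem π hz⟩, rfl, hz⟩
  have hrep (q : π '' K) : ∃ y ∈ K, π y = q := q.2
  choose y hyK hyπ using hrep
  refine ⟨π '' K, inferInstance, fun q => μ.real (piece q), y, hyK, fun g hg => ?_⟩
  have hval (q : π '' K) : EqOn g (fun _ => g (y q)) (piece q) := fun z hz => by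
    simpa using hg (y q) (hyK q) (-y q + z) (QuotientAddGroup.eq.1 ((hyπ q).trans hz.1.symm))
  have hfin (q : π '' K) : μ (piece q) ≠ ⊤ := measure_ne_top_of_subset inter_subset_right hμ
  calc ∫ y in K, g y ∂μ = ∑ q, ∫ z in piece q, g z ∂μ := by
        conv_lhs => rw [← hunion]
        exact integral_iUnion_fintype hmeas hdisj fun q =>
          (integrableOn_const (hfin q)).congr_fun (hval q).symm (hmeas q)
    _ = ∑ q, μ.real (piece q) • g (y q) := Finset.sum_congr rfl fun q _ => by
        rw [setIntegral_congr_fun (hmeas q) (hval q), setIntegral_const]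

end Quadrature

section Averages

/-- The mean value `A_j g` of `g` over the ball of radius `p ^ j` about `x`. -/
def ballAvg (j : ℤ) (g : (Fin n → ℚ_[p]) → ℂ) (x : Fin n → ℚ_[p]) : ℂ :=
  ⨍ y in (padicBall p n j : Set (Fin n → ℚ_[p])), g (x - y)

/-- The component `A_i g - A_{i + 1} g` of `g` in the eigenspace of the Taibleson operator with
eigenvalue `p ^ (-α i)`. -/
def ballDiff (i : ℤ) (g : (Fin n → ℚ_[p]) → ℂ) (x : Fin n → ℚ_[p]) : ℂ :=
  ballAvg i g x - ballAvg (i + 1) g x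

variable {i j k l : ℤ} {g h : (Fin n → ℚ_[p]) → ℂ} {x y : Fin n → ℚ_[p]}

theorem volume_padicBall_ne_top (j : ℤ) :
    volume (padicBall p n j : Set (Fin n → ℚ_[p])) ≠ ⊤ :=
  (isCompact_padicBall j).measure_lt_top.ne

theorem volume_padicBall_ne_zero (j : ℤ) :
    volume (padicBall p n j : Set (Fin n → ℚ_[p])) ≠ 0 := fun h => by
  have hp := prime_cast_pos p
  have hV := measureReal_padicBall (p := p) (n := n) j
  rw [measureReal_def, h, ENNReal.toReal_zero] at hV
  exact (show (0 : ℝ) < ((p : ℝ) ^ n) ^ j by positivity).ne hV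

theorem norm_ballAvg_le {b : ℝ} (h : ∀ y ∈ padicBall p n j, ‖g (x - y)‖ ≤ b) :
    ‖ballAvg j g x‖ ≤ b := by
  have hV : 0 < volume.real (padicBall p n j : Set (Fin n → ℚ_[p])) :=
    ENNReal.toReal_pos (volume_padicBall_ne_zero j) (volume_padicBall_ne_top j)
  rw [ballAvg, setAverage_eq, norm_smul, norm_inv, Real.norm_of_nonneg hV.le,
    inv_mul_le_iff₀ hV, mul_comm]
  exact norm_setIntegral_le_of_norm_le_const (volume_padicBall_ne_top j).lt_top h

theorem ConstAt.ballAvg_eq (h : ConstAt l g x) (hjl : j ≤ l) : ballAvg j g x = g x := by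
  rw [ballAvg, setAverage_eq, setIntegral_congr_fun (measurableSet_padicBall j)
    fun y hy => h.eq_sub (padicBall_mono hjl hy), ← setAverage_eq,
    setAverage_const (volume_padicBall_ne_zero j) (volume_padicBall_ne_top j)]

theorem constAt_ballAvg_self (j : ℤ) (g : (Fin n → ℚ_[p]) → ℂ) (x : Fin n → ℚ_[p]) :
    ConstAt j (ballAvg j g) x := constAt_iff.2 fun y hy => by
  have hind (z : Fin n → ℚ_[p]) :
      (padicBall p n j : Set (Fin n → ℚ_[p])).indicator (fun z => g (x + y - z)) (y + z) =
        (padicBall p n j : Set (Fin n → ℚ_[p])).indicator (fun z => g (x - z)) z := by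
    have hmem : y + z ∈ (padicBall p n j : Set (Fin n → ℚ_[p])) ↔
        z ∈ (padicBall p n j : Set (Fin n → ℚ_[p])) := add_mem_cancel_left hy
    rw [add_comm x y, indicator_eq_indicator hmem (by rw [add_sub_add_left_eq_sub])]
  rw [ballAvg, ballAvg, setAverage_eq, setAverage_eq,
    ← integral_indicator (measurableSet_padicBall j),
    ← integral_indicator (measurableSet_padicBall j), ← integral_add_left_eq_self _ y]
  simp only [hind]

theorem ConstAt.ballAvg (h : ConstAt l g x) (j : ℤ) : ConstAt l (PadicHeat.ballAvg j g) x := by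
  rcases le_total l j with hlj | hjl
  · exact (constAt_ballAvg_self j g x).mono hlj
  · exact constAt_iff.2 fun y hy => by
      rw [(h.translate hy).ballAvg_eq hjl, h.ballAvg_eq hjl, constAt_iff.1 h y hy]

theorem ConstAt.ballDiff (h : ConstAt l g x) (i : ℤ) : ConstAt l (PadicHeat.ballDiff i g) x :=
  fun y hy => congrArg₂ (· - ·) (h.ballAvg i y hy) (h.ballAvg (i + 1) y hy)

theorem ConstAt.ballDiff_eq_zero (h : ConstAt l g x) (hil : i < l) :
    PadicHeat.ballDiff i g x = 0 := by
  rw [PadicHeat.ballDiff, h.ballAvg_eq hil.le, h.ballAvg_eq hil, sub_self]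

theorem ConstAt.ballAvg_sub_self (h : ConstAt l g x) (j : ℤ) :
    PadicHeat.ballAvg j g x - g x = -∑ i ∈ Finset.Ico l j, PadicHeat.ballDiff i g x := by
  rcases le_total j l with hjl | hlj
  · rw [h.ballAvg_eq hjl, Finset.Ico_eq_empty_of_le hjl, Finset.sum_empty, sub_self, neg_zero]
  induction j, hlj using Int.leInduction with
  | base => simp [h.ballAvg_eq le_rfl]
  | succ j hlj ih =>
    rw [← Finset.insert_Ico_right_eq_Ico_add_one hlj, Finset.sum_insert Finset.right_notMem_Ico,
      neg_add, ← ih, PadicHeat.ballDiff]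
    ring

theorem continuous_ballAvg (j : ℤ) (g : (Fin n → ℚ_[p]) → ℂ) : Continuous (ballAvg j g) :=
  (isLocallyConstant_of_constAt (constAt_ballAvg_self j g)).continuous

theorem integrableOn_padicBall (hg : Continuous g) (j : ℤ) (x : Fin n → ℚ_[p]) :
    IntegrableOn (fun y => g (x - y)) (padicBall p n j : Set (Fin n → ℚ_[p])) :=
  (by fun_prop : Continuous fun y => g (x - y)).continuousOn.integrableOn_compact
    (isCompact_padicBall j)

theorem ballAvg_sub (hg : Continuous g) (hh : Continuous h) (j : ℤ) (x : Fin n → ℚ_[p]) :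
    ballAvg j (fun z => g z - h z) x = ballAvg j g x - ballAvg j h x := by
  simp only [ballAvg, setAverage_eq]
  rw [integral_sub (integrableOn_padicBall hg j x) (integrableOn_padicBall hh j x), smul_sub]

theorem ballAvg_comm (hg : Continuous g) (i j : ℤ) (x : Fin n → ℚ_[p]) :
    ballAvg i (ballAvg j g) x = ballAvg j (ballAvg i g) x := by
  have hint : Integrable (Function.uncurry fun y z : Fin n → ℚ_[p] => g (x - y - z))
      ((volume.restrict (padicBall p n i : Set _)).prod
        (volume.restrict (padicBall p n j : Set _))) := by
    rw [Measure.prod_restrict]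
    exact (by fun_prop : Continuous _).continuousOn.integrableOn_compact
      ((isCompact_padicBall i).prod (isCompact_padicBall j))
  simp only [ballAvg, setAverage_eq, integral_smul]
  rw [integral_integral_swap hint, smul_comm]
  simp only [sub_right_comm]

theorem ballAvg_ballAvg (hg : Continuous g) (i j : ℤ) (x : Fin n → ℚ_[p]) :
    ballAvg i (ballAvg j g) x = ballAvg (max i j) g x := by
  rcases le_total i j with hij | hji
  · rw [(constAt_ballAvg_self j g x).ballAvg_eq hij, max_eq_right hij]
  · rw [ballAvg_comm hg, (constAt_ballAvg_self i g x).ballAvg_eq hji, max_eq_left hji]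

theorem ballDiff_ballDiff (hg : Continuous g) (i k : ℤ) (x : Fin n → ℚ_[p]) :
    ballDiff i (ballDiff k g) x = if i = k then ballDiff k g x else 0 := by
  have hA (j : ℤ) : ballAvg j (ballDiff k g) x =
      ballAvg (max j k) g x - ballAvg (max j (k + 1)) g x := by
    rw [← ballAvg_ballAvg hg, ← ballAvg_ballAvg hg]
    exact ballAvg_sub (continuous_ballAvg k g) (continuous_ballAvg (k + 1) g) j x
  rw [ballDiff, hA, hA]
  rcases lt_trichotomy i k with hik | rfl | hki
  · rw [if_neg hik.ne, max_eq_right hik.le, max_eq_right (by lia), max_eq_right (by lia),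
      max_eq_right (by lia), sub_self]
  · rw [if_pos rfl, max_self, max_self, max_eq_right (by lia), max_eq_left (by lia), sub_self,
      sub_zero, ballDiff]
  · rw [if_neg hki.ne', max_eq_left (by lia), max_eq_left (by lia), max_eq_left (by lia),
      max_eq_left (by lia), sub_self, sub_self, sub_self]

theorem exists_ballAvg_eq_sum (l : (Fin n → ℚ_[p]) → ℤ) (j : ℤ) (x : Fin n → ℚ_[p]) :
    ∃ (ι : Type) (_ : Fintype ι) (c : ι → ℝ) (z : ι → Fin n → ℚ_[p]),
      ∀ g : (Fin n → ℚ_[p]) → ℂ, (∀ x, ConstAt (l x) g x) →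
        ballAvg j g x = ∑ i, c i • g (z i) := by
  obtain ⟨m, hm⟩ := exists_forall_constAt_of_isCompact l
    ((isCompact_padicBall (p := p) (n := n) j).image (continuous_sub_left x))
  obtain ⟨ι, _, c, y, -, hsum⟩ := exists_setIntegral_eq_sum (E := ℂ) volume (padicBall p n m)
    (isCompact_padicBall j) (measurableSet_padicBall j) (volume_padicBall_ne_top j)
  refine ⟨ι, inferInstance, fun i => (volume.real (padicBall p n j : Set (Fin n → ℚ_[p])))⁻¹ * c i,
    fun i => x - y i, fun g hg => ?_⟩
  rw [ballAvg, setAverage_eq, hsum (fun z => g (x - z)) fun z hz u hu => by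
    rw [← sub_sub, (hm g hg _ (mem_image_of_mem _ hz)).eq_sub hu], Finset.smul_sum]
  simp only [mul_smul]

theorem exists_ballDiff_eq_sum (l : (Fin n → ℚ_[p]) → ℤ) (i : ℤ) (x : Fin n → ℚ_[p]) :
    ∃ (ι : Type) (_ : Fintype ι) (c : ι → ℝ) (z : ι → Fin n → ℚ_[p]),
      ∀ g : (Fin n → ℚ_[p]) → ℂ, (∀ x, ConstAt (l x) g x) →
        ballDiff i g x = ∑ k, c k • g (z k) := by
  obtain ⟨ι, _, c, z, hz⟩ := exists_ballAvg_eq_sum l i x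
  obtain ⟨ι', _, c', z', hz'⟩ := exists_ballAvg_eq_sum l (i + 1) x
  refine ⟨ι ⊕ ι', inferInstance, Sum.elim c (-c'), Sum.elim z z', fun g hg => ?_⟩
  simp [ballDiff, hz g hg, hz' g hg, Fintype.sum_sum_type, sub_eq_add_neg]

theorem ballDiff_add {l : (Fin n → ℚ_[p]) → ℤ} (hg : ∀ x, ConstAt (l x) g x)
    (hh : ∀ x, ConstAt (l x) h x) (i : ℤ) (x : Fin n → ℚ_[p]) :
    ballDiff i (fun z => g z + h z) x = ballDiff i g x + ballDiff i h x := by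
  obtain ⟨ι, _, c, z, hz⟩ := exists_ballDiff_eq_sum l i x
  rw [hz g hg, hz h hh, hz _ fun x y hy => congrArg₂ (· + ·) (hg x y hy) (hh x y hy),
    ← Finset.sum_add_distrib]
  simp only [smul_add]

theorem ballDiff_smul {l : (Fin n → ℚ_[p]) → ℤ} (hg : ∀ x, ConstAt (l x) g x) (r : ℝ)
    (i : ℤ) (x : Fin n → ℚ_[p]) :
    ballDiff i (fun z => r • g z) x = r • ballDiff i g x := by
  obtain ⟨ι, _, c, z, hz⟩ := exists_ballDiff_eq_sum l i x
  rw [hz g hg, hz _ fun x y hy => congrArg (r • ·) (hg x y hy), Finset.smul_sum]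
  exact Finset.sum_congr rfl fun k _ => smul_comm _ _ _

theorem hasSum_ballDiff {κ : Type*} {G : κ → (Fin n → ℚ_[p]) → ℂ} {l : (Fin n → ℚ_[p]) → ℤ}
    (hG : ∀ k x, ConstAt (l x) (G k) x) (hsum : ∀ z, HasSum (fun k => G k z) (g z)) (i : ℤ)
    (x : Fin n → ℚ_[p]) : HasSum (fun k => ballDiff i (G k) x) (ballDiff i g x) := by
  have hg : ∀ x, ConstAt (l x) g x := fun x y hy =>
    (hsum (x + y)).unique (by simpa only [hG _ x y hy] using hsum x)
  obtain ⟨ι, _, c, z, hz⟩ := exists_ballDiff_eq_sum l i x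
  simp only [hz g hg, hz _ (hG _)]
  exact hasSum_sum fun k _ => (hsum (z k)).const_smul (c k)

theorem ballDiff_intervalIntegral {G : ℝ → (Fin n → ℚ_[p]) → ℂ} {l : (Fin n → ℚ_[p]) → ℤ}
    {s t : ℝ} (hG : ∀ τ ∈ uIoo s t, ∀ x, ConstAt (l x) (G τ) x)
    (hint : ∀ z, IntervalIntegrable (fun τ => G τ z) volume s t) (i : ℤ)
    (x : Fin n → ℚ_[p]) :
    ballDiff i (fun z => ∫ τ in s..t, G τ z) x = ∫ τ in s..t, ballDiff i (G τ) x := by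
  obtain ⟨ι, _, c, z, hz⟩ := exists_ballDiff_eq_sum l i x
  calc ballDiff i (fun z => ∫ τ in s..t, G τ z) x = ∑ k, c k • ∫ τ in s..t, G τ (z k) :=
        hz _ fun x => .intervalIntegral fun τ hτ => hG τ hτ x
    _ = ∫ τ in s..t, ∑ k, c k • G τ (z k) := by
        simp only [← intervalIntegral.integral_smul]
        exact (intervalIntegral.integral_finsetSum fun k _ => (hint (z k)).smul (c k)).symm
    _ = ∫ τ in s..t, ballDiff i (G τ) x :=
        intervalIntegral.integral_congr_uIoo fun τ hτ => (hz _ (hG τ hτ)).symm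

end Averages

section Growth

/-- `g ∈ 𝔐_λ` with growth constant `C` and with `g` constant on the ball of radius `p ^ l(x)` about
every `x`. -/
structure MemMWith (lam C : ℝ) (l : (Fin n → ℚ_[p]) → ℤ) (g : (Fin n → ℚ_[p]) → ℂ) : Prop where
  constAt : ∀ x, ConstAt (l x) g x
  norm_le : ∀ x, ‖g x‖ ≤ C * (1 + ‖x‖ ^ lam)

/-- The eigenvalue `p ^ (-α i)` of the Taibleson operator on the range of `ballDiff i`. -/
def eigenvalue (p : ℕ) (α : ℝ) (i : ℤ) : ℝ := ((p : ℝ) ^ α) ^ (-i)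

/-- A bound, for functions of growth `lam` with constant `C` that are constant on the ball of radius
`p ^ m` about a point of norm `r`, on their oscillation over the ball of radius `p ^ j`. -/
def oscBound (p : ℕ) (lam C r : ℝ) (m j : ℤ) : ℝ :=
  (Ioi m).indicator (fun j => 2 * (C * (1 + r ^ lam + ((p : ℝ) ^ lam) ^ j))) j

variable {lam C α : ℝ} {l : (Fin n → ℚ_[p]) → ℤ} {g : (Fin n → ℚ_[p]) → ℂ}
  {x y : Fin n → ℚ_[p]} {i j : ℤ}

theorem MemMWith.continuous (hg : MemMWith lam C l g) : Continuous g :=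
  (isLocallyConstant_of_constAt hg.constAt).continuous

theorem MemMWith.nonneg (hg : MemMWith lam C l g) : 0 ≤ C := by
  have h : (0 : ℝ) < 1 + ‖(0 : Fin n → ℚ_[p])‖ ^ lam := by positivity
  exact nonneg_of_mul_nonneg_left ((norm_nonneg _).trans (hg.norm_le 0)) h

theorem norm_sub_rpow_le (hlam : 0 ≤ lam) (x : Fin n → ℚ_[p]) (hy : y ∈ padicBall p n j) :
    ‖x - y‖ ^ lam ≤ ‖x‖ ^ lam + ((p : ℝ) ^ lam) ^ j := by
  have hp := prime_cast_pos p
  have hle : ‖x - y‖ ≤ max ‖x‖ ((p : ℝ) ^ j) :=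
    (sub_eq_add_neg x y ▸ IsUltrametricDist.norm_add_le_max x (-y)).trans
      (max_le_max_left _ (mem_padicBall.1 (neg_mem hy)))
  calc ‖x - y‖ ^ lam ≤ max ‖x‖ ((p : ℝ) ^ j) ^ lam :=
        Real.rpow_le_rpow (norm_nonneg _) hle hlam
    _ ≤ ‖x‖ ^ lam + ((p : ℝ) ^ j) ^ lam := by
        rcases max_choice ‖x‖ ((p : ℝ) ^ j) with h | h <;> rw [h]
        · exact le_add_of_nonneg_right (by positivity)
        · exact le_add_of_nonneg_left (by positivity)
    _ = ‖x‖ ^ lam + ((p : ℝ) ^ lam) ^ j := by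
        rw [← Real.rpow_intCast, ← Real.rpow_mul hp.le, mul_comm, Real.rpow_mul hp.le,
          Real.rpow_intCast]

theorem MemMWith.norm_sub_le (hg : MemMWith lam C l g) (hlam : 0 ≤ lam) (x : Fin n → ℚ_[p])
    (hy : y ∈ padicBall p n j) : ‖g (x - y)‖ ≤ C * (1 + ‖x‖ ^ lam + ((p : ℝ) ^ lam) ^ j) := by
  refine (hg.norm_le _).trans (mul_le_mul_of_nonneg_left ?_ hg.nonneg)
  rw [add_assoc]
  gcongr
  exact norm_sub_rpow_le hlam x hy

theorem MemMWith.norm_ballAvg_le (hg : MemMWith lam C l g) (hlam : 0 ≤ lam) (j : ℤ)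
    (x : Fin n → ℚ_[p]) : ‖ballAvg j g x‖ ≤ C * (1 + ‖x‖ ^ lam + ((p : ℝ) ^ lam) ^ j) :=
  PadicHeat.norm_ballAvg_le fun _ hy => hg.norm_sub_le hlam x hy

theorem MemMWith.norm_sub_sub_le (hg : MemMWith lam C l g) (hlam : 0 ≤ lam) (x : Fin n → ℚ_[p])
    (hy : y ∈ padicBall p n j) : ‖g (x - y) - g x‖ ≤ oscBound p lam C ‖x‖ (l x) j := by
  rw [oscBound]
  by_cases hj : j ∈ Ioi (l x)
  · rw [indicator_of_mem hj, two_mul]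
    refine (_root_.norm_sub_le _ _).trans (add_le_add (hg.norm_sub_le hlam x hy) ?_)
    simpa using hg.norm_sub_le hlam x (zero_mem (padicBall p n j))
  · rw [indicator_of_notMem hj, (hg.constAt x).eq_sub (padicBall_mono (not_lt.1 hj) hy), sub_self,
      norm_zero]

theorem MemMWith.norm_ballDiff_le (hg : MemMWith lam C l g) (hlam : 0 ≤ lam) (i : ℤ)
    (x : Fin n → ℚ_[p]) : ‖ballDiff i g x‖ ≤ oscBound p lam C ‖x‖ (l x) (i + 1) := by
  have hp := one_lt_prime_cast p
  rw [oscBound]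
  by_cases hi : i + 1 ∈ Ioi (l x)
  · rw [indicator_of_mem hi, two_mul]
    have hmono : ((p : ℝ) ^ lam) ^ i ≤ ((p : ℝ) ^ lam) ^ (i + 1) :=
      zpow_le_zpow_right₀ (Real.one_le_rpow hp.le hlam) (by lia)
    refine (_root_.norm_sub_le _ _).trans (add_le_add ((hg.norm_ballAvg_le hlam i x).trans ?_)
      (hg.norm_ballAvg_le hlam (i + 1) x))
    exact mul_le_mul_of_nonneg_left (by gcongr) hg.nonneg
  · rw [(hg.constAt x).ballDiff_eq_zero (by simpa using hi), norm_zero, indicator_of_notMem hi]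

theorem eigenvalue_pos (α : ℝ) (i : ℤ) : 0 < eigenvalue p α i :=
  zpow_pos (Real.rpow_pos_of_pos (prime_cast_pos p) α) _

theorem eigenvalue_sub_one (α : ℝ) (i : ℤ) :
    eigenvalue p α (i - 1) = (p : ℝ) ^ α * eigenvalue p α i := by
  rw [eigenvalue, eigenvalue, ← zpow_one_add₀ (Real.rpow_pos_of_pos (prime_cast_pos p) α).ne',
    show -(i - 1) = 1 + -i by ring]

theorem summable_eigenvalue_mul_oscBound (hlam : 0 ≤ lam) (hlamα : lam < α) (C r : ℝ) (m : ℤ) :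
    Summable fun j => eigenvalue p α j * oscBound p lam C r m j := by
  have hp := one_lt_prime_cast p
  have hQ : 1 < (p : ℝ) ^ α := Real.one_lt_rpow hp (hlam.trans_lt hlamα)
  have hR : 0 < (p : ℝ) ^ lam := Real.rpow_pos_of_pos (prime_cast_pos p) lam
  have hRQ : (p : ℝ) ^ lam / (p : ℝ) ^ α < 1 :=
    (div_lt_one (by positivity)).2 (Real.rpow_lt_rpow_of_exponent_lt hp hlamα)
  refine (((summable_indicator_Ioi_zpow (inv_pos.2 (one_pos.trans hQ)) (inv_lt_one_of_one_lt₀ hQ)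
    m).mul_left (2 * (C * (1 + r ^ lam)))).add ((summable_indicator_Ioi_zpow
    (div_pos hR (one_pos.trans hQ)) hRQ m).mul_left (2 * C))).congr fun j => ?_
  by_cases hj : j ∈ Ioi m
  · simp only [oscBound, eigenvalue, indicator_of_mem hj, div_zpow, inv_zpow', zpow_neg]
    ring
  · simp only [oscBound, indicator_of_notMem hj, mul_zero, add_zero]

theorem summable_eigenvalue_mul_oscBound_add_one (hlam : 0 ≤ lam) (hlamα : lam < α) (C r : ℝ)
    (m : ℤ) : Summable fun i => eigenvalue p α i * oscBound p lam C r m (i + 1) := by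
  rw [← (Equiv.subRight (1 : ℤ)).summable_iff]
  simpa only [Function.comp_def, Equiv.subRight_apply, sub_add_cancel, eigenvalue_sub_one,
    mul_assoc] using (summable_eigenvalue_mul_oscBound hlam hlamα C r m).mul_left ((p : ℝ) ^ α)

theorem MemMWith.summable_eigenvalue_mul_norm_ballDiff (hg : MemMWith lam C l g) (hlam : 0 ≤ lam)
    (hlamα : lam < α) (x : Fin n → ℚ_[p]) :
    Summable fun i => eigenvalue p α i * ‖ballDiff i g x‖ :=
  .of_nonneg_of_le (fun i => mul_nonneg (eigenvalue_pos α i).le (norm_nonneg _))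
    (fun i => mul_le_mul_of_nonneg_left (hg.norm_ballDiff_le hlam i x) (eigenvalue_pos α i).le)
    (summable_eigenvalue_mul_oscBound_add_one hlam hlamα C ‖x‖ (l x))

end Growth

section Taibleson

theorem hasSum_indicator_padicBall {F : ℤ → ℝ} {B : ℝ} (hF : Monotone F)
    (hB : Tendsto F atTop (𝓝 B)) {y : Fin n → ℚ_[p]} {m : ℤ} (hy : ‖y‖ = (p : ℝ) ^ m) :
    HasSum (fun j => (padicBall p n j : Set (Fin n → ℚ_[p])).indicator
      (fun _ => ((F j - F (j - 1) : ℝ) : ℂ)) y) ((B - F (m - 1) : ℝ) : ℂ) := by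
  convert Complex.hasSum_ofReal.2 (hasSum_indicator_Ioi_sub hF hB (m - 1)) using 2 with j
  by_cases hj : m ≤ j
  · rw [indicator_of_mem ((mem_padicBall_iff_le hy).2 hj), indicator_of_mem (mem_Ioi.2 (by lia))]
  · rw [indicator_of_notMem (mt (mem_padicBall_iff_le hy).1 hj),
      indicator_of_notMem (by simpa using hj), Complex.ofReal_zero]

variable {lam C α : ℝ} {l : (Fin n → ℚ_[p]) → ℤ} {g : (Fin n → ℚ_[p]) → ℂ}

theorem monotone_neg_zpow_neg {r : ℝ} (hr : 1 ≤ r) : Monotone fun j : ℤ => -r ^ (-j) :=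
  fun _ _ hij => neg_le_neg (zpow_le_zpow_right₀ hr (neg_le_neg hij))

theorem tendsto_neg_zpow_neg {r : ℝ} (hr : 1 < r) :
    Tendsto (fun j : ℤ => -r ^ (-j)) atTop (𝓝 0) := by
  simpa only [inv_zpow', neg_zero] using
    (tendsto_zpow_atTop_zero (inv_pos.2 (one_pos.trans hr)) (inv_lt_one_of_one_lt₀ hr)).neg

theorem rpow_neg_sub_natCast_lt_one (hα : 0 < α) (n : ℕ) : (p : ℝ) ^ (-α - n) < 1 :=
  Real.rpow_lt_one_of_one_lt_of_neg (one_lt_prime_cast p) (by linarith [n.cast_nonneg (α := ℝ)])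

theorem hasSum_norm_rpow (hα : 0 < α) {y : Fin n → ℚ_[p]} (hy : y ≠ 0) :
    HasSum (fun j => (padicBall p n j : Set (Fin n → ℚ_[p])).indicator
      (fun _ => (((1 - (p : ℝ) ^ (-α - n)) * ((p : ℝ) ^ (-α - n)) ^ j : ℝ) : ℂ)) y)
      ((‖y‖ ^ (-α - (n : ℝ)) : ℝ) : ℂ) := by
  obtain ⟨m, hm⟩ := exists_norm_eq_zpow hy
  have hp := prime_cast_pos p
  set r : ℝ := (p : ℝ) ^ (-α - n) with hr
  have hr0 : 0 < r := Real.rpow_pos_of_pos hp _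
  have hr1 : r < 1 := rpow_neg_sub_natCast_lt_one hα n
  have hF : Monotone fun j : ℤ => -r ^ (j + 1) := fun i j hij =>
    neg_le_neg (zpow_le_zpow_right_of_le_one₀ hr0 hr1.le (by lia))
  have hB : Tendsto (fun j : ℤ => -r ^ (j + 1)) atTop (𝓝 0) := by
    simpa using ((tendsto_zpow_atTop_zero hr0 hr1).comp
      (tendsto_atTop_add_const_right _ 1 tendsto_id)).neg
  convert hasSum_indicator_padicBall hF hB hm using 2 with j
  · congr! 3
    rw [sub_add_cancel, zpow_add_one₀ hr0.ne']
    ring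
  · rw [hm, sub_add_cancel, zero_sub, neg_neg, hr, ← Real.rpow_intCast, ← Real.rpow_intCast,
      ← Real.rpow_mul hp.le, ← Real.rpow_mul hp.le, mul_comm]

theorem rpow_zpow_mul_measureReal_padicBall (α : ℝ) (j : ℤ) :
    ((p : ℝ) ^ (-α - n)) ^ j * volume.real (padicBall p n j : Set (Fin n → ℚ_[p])) =
      eigenvalue p α j := by
  have hp := prime_cast_pos p
  rw [measureReal_padicBall, ← mul_zpow, ← Real.rpow_natCast, ← Real.rpow_add hp, sub_add_cancel,
    Real.rpow_neg hp.le, inv_zpow', eigenvalue]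

theorem setAverage_sub_const (hg : Continuous g) (j : ℤ) (x : Fin n → ℚ_[p]) (c : ℂ) :
    ⨍ y in (padicBall p n j : Set (Fin n → ℚ_[p])), (g (x - y) - c) = ballAvg j g x - c := by
  have hc : ballAvg j (fun _ : Fin n → ℚ_[p] => c) x = c :=
    ConstAt.ballAvg_eq (l := j) (fun _ _ => rfl) le_rfl
  calc _ = ballAvg j (fun z => g z - c) x := rfl
    _ = ballAvg j g x - c := by rw [ballAvg_sub hg continuous_const, hc]

theorem integrable_and_hasSum_taiblesonIntegrand (hg : MemMWith lam C l g) (hlam : 0 ≤ lam)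
    (hlamα : lam < α) (x : Fin n → ℚ_[p]) :
    Integrable (taiblesonIntegrand α g x) ∧
      HasSum (fun j => ((1 - (p : ℝ) ^ (-α - n)) * eigenvalue p α j) • (ballAvg j g x - g x))
        (∫ y, taiblesonIntegrand α g x y) := by
  have hα : 0 < α := hlam.trans_lt hlamα
  have hκ := sub_nonneg.2 (rpow_neg_sub_natCast_lt_one (p := p) hα n).le
  have hcont : Continuous fun y => g (x - y) - g x := by
    have := hg.continuous
    fun_prop
  have hmain := integrable_and_hasSum_integral_mul_of_hasSum_indicator (μ := volume)
    (s := fun j => (padicBall p n j : Set (Fin n → ℚ_[p])))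
    (κ := fun j => (1 - (p : ℝ) ^ (-α - n)) * ((p : ℝ) ^ (-α - n)) ^ j)
    (b := oscBound p lam C ‖x‖ (l x)) (h := fun y => g (x - y) - g x)
    (fun j => measurableSet_padicBall j) (fun j => volume_padicBall_ne_top j)
    (fun j => mul_nonneg hκ (by positivity)) hcont.aestronglyMeasurable
    (fun j y hy => hg.norm_sub_sub_le hlam x hy) ?_
    fun y hy => hasSum_norm_rpow hα fun h0 => hy (by simp [h0])
  · simpa only [mul_assoc, rpow_zpow_mul_measureReal_padicBall,
      setAverage_sub_const hg.continuous] using! hmain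
  · simpa only [mul_assoc, rpow_zpow_mul_measureReal_padicBall] using
      (summable_eigenvalue_mul_oscBound hlam hlamα C ‖x‖ (l x)).mul_left _

theorem taibleson_eq_tsum (hg : MemMWith lam C l g) (hlam : 0 ≤ lam) (hlamα : lam < α)
    (x : Fin n → ℚ_[p]) :
    taibleson α g x = ∑' i, eigenvalue p α i • ballDiff i g x := by
  have hα : 0 < α := hlam.trans_lt hlamα
  have hQ : 1 < (p : ℝ) ^ α := Real.one_lt_rpow (one_lt_prime_cast p) hα
  have hκ : 1 - (p : ℝ) ^ (-α - n) ≠ 0 := (sub_pos.2 (rpow_neg_sub_natCast_lt_one hα n)).ne'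
  have habel := hasSum_sub_smul_sum_Ico (F := fun j => -eigenvalue p α j) (l := l x)
    (d := fun i => ballDiff i g x) (monotone_neg_zpow_neg hQ.le) (tendsto_neg_zpow_neg hQ)
    (fun i hi => (hg.constAt x).ballDiff_eq_zero hi)
    (by simpa using hg.summable_eigenvalue_mul_norm_ballDiff hlam hlamα x)
  simp only [zero_sub, neg_neg] at habel
  have hD := (integrable_and_hasSum_taiblesonIntegrand hg hlam hlamα x).2.const_smul
    ((1 - (p : ℝ) ^ α) / (1 - (p : ℝ) ^ (-α - n)))
  rw [taibleson, ← Complex.real_smul]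
  refine hD.unique (habel.congr_fun fun j => ?_)
  rw [(hg.constAt x).ballAvg_sub_self, eigenvalue_sub_one, smul_neg, smul_neg, smul_smul,
    ← neg_smul]
  congr 1
  field_simp
  ring

end Taibleson

section HeatWeights

/-- The factor `exp (-a p ^ (-α i) t)` by which the heat semigroup acts on the `i`-th component
`ballDiff i`. -/
def heatFactor (p : ℕ) (a α t : ℝ) (i : ℤ) : ℝ := Real.exp (-(a * eigenvalue p α i * t))

/-- The weight of the ball average `ballAvg j` in the heat semigroup at time `t`. -/
def heatWeight (p : ℕ) (a α t : ℝ) (j : ℤ) : ℝ := heatFactor p a α t j - heatFactor p a α t (j - 1)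

variable {a α t : ℝ}

theorem heatFactor_le_one (ha : 0 ≤ a) (ht : 0 ≤ t) (i : ℤ) : heatFactor p a α t i ≤ 1 :=
  Real.exp_le_one_iff.2 (neg_nonpos.2 (mul_nonneg (mul_nonneg ha (eigenvalue_pos α i).le) ht))

theorem one_sub_heatFactor_le (p : ℕ) (a α t : ℝ) (i : ℤ) :
    1 - heatFactor p a α t i ≤ a * t * eigenvalue p α i := by
  rw [heatFactor]
  linarith [Real.add_one_le_exp (-(a * eigenvalue p α i * t))]

theorem norm_heatFactor_sub_one_le (ha : 0 ≤ a) (ht : 0 ≤ t) (i : ℤ) :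
    ‖heatFactor p a α t i - 1‖ ≤ a * t * eigenvalue p α i := by
  rw [norm_sub_rev, Real.norm_of_nonneg (sub_nonneg.2 (heatFactor_le_one ha ht i))]
  exact one_sub_heatFactor_le p a α t i

theorem eigenvalue_antitone (hα : 0 ≤ α) : Antitone (eigenvalue p α) := fun _ _ hij =>
  zpow_le_zpow_right₀ (Real.one_le_rpow (one_lt_prime_cast p).le hα) (neg_le_neg hij)

theorem heatFactor_monotone (ha : 0 ≤ a) (hα : 0 ≤ α) (ht : 0 ≤ t) :
    Monotone (heatFactor p a α t) := fun _ _ hij =>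
  Real.exp_le_exp.2 (neg_le_neg (mul_le_mul_of_nonneg_right
    (mul_le_mul_of_nonneg_left (eigenvalue_antitone hα hij) ha) ht))

theorem tendsto_eigenvalue_atTop (hα : 0 < α) : Tendsto (eigenvalue p α) atTop (𝓝 0) := by
  simpa only [neg_neg, neg_zero] using!
    (tendsto_neg_zpow_neg (Real.one_lt_rpow (one_lt_prime_cast p) hα)).neg

theorem tendsto_heatFactor_atTop (hα : 0 < α) (a t : ℝ) :
    Tendsto (heatFactor p a α t) atTop (𝓝 1) := by
  simpa using! (((tendsto_eigenvalue_atTop (p := p) hα).const_mul a).mul_const t).neg.rexp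

theorem heatFactor_le_pow (ha : 0 < a) (ht : 0 < t) (i : ℤ) (k : ℕ) :
    heatFactor p a α t i ≤ k.factorial / (a * t) ^ k * (((p : ℝ) ^ α) ^ k) ^ i := by
  have hp := prime_cast_pos p
  have hx : 0 < a * eigenvalue p α i * t := mul_pos (mul_pos ha (eigenvalue_pos α i)) ht
  have hexp := inv_anti₀ (by positivity) (Real.pow_div_factorial_le_exp _ hx.le k)
  rw [← Real.exp_neg, inv_div] at hexp
  refine hexp.trans_eq ?_
  rw [eigenvalue, mul_right_comm, mul_pow, zpow_neg, inv_pow, ← zpow_natCast, ← zpow_natCast,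
    ← zpow_natCast, zpow_comm]
  field_simp

theorem tendsto_heatFactor_atBot (ha : 0 < a) (hα : 0 < α) (ht : 0 < t) :
    Tendsto (heatFactor p a α t) atBot (𝓝 0) := by
  have hQ : 1 < (p : ℝ) ^ α := Real.one_lt_rpow (one_lt_prime_cast p) hα
  refine squeeze_zero (fun i => (Real.exp_pos _).le) (fun i => heatFactor_le_pow ha ht i 1) ?_
  have h := (tendsto_zpow_atTop_zero (inv_pos.2 (one_pos.trans hQ))
    (inv_lt_one_of_one_lt₀ hQ)).comp tendsto_neg_atBot_atTop
  simpa only [Function.comp_def, inv_zpow', neg_neg, mul_zero, pow_one] using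
    h.const_mul ((1 : ℕ).factorial / (a * t))

theorem heatWeight_nonneg (ha : 0 ≤ a) (hα : 0 ≤ α) (ht : 0 ≤ t) (j : ℤ) :
    0 ≤ heatWeight p a α t j :=
  sub_nonneg.2 (heatFactor_monotone ha hα ht (by lia))

theorem hasSum_heatWeight (ha : 0 < a) (hα : 0 < α) (ht : 0 < t) :
    HasSum (heatWeight p a α t) 1 := by
  simpa only [sub_zero] using! hasSum_int_sub (heatFactor_monotone ha.le hα.le ht.le)
    (tendsto_heatFactor_atBot ha hα ht) (tendsto_heatFactor_atTop (p := p) hα a t)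

theorem heatWeight_mul_zpow_le {r : ℝ} (ha : 0 ≤ a) (hα : 0 ≤ α) (hr : 1 ≤ r) (ht : 0 ≤ t)
    (j : ℤ) : heatWeight p a α t j * r ^ j ≤ heatWeight p a α t j +
      a * t * (p : ℝ) ^ α * (Ioi 0).indicator (fun j : ℤ => (r / (p : ℝ) ^ α) ^ j) j := by
  have hw := heatWeight_nonneg (p := p) ha hα ht j
  by_cases hj : 0 < j
  · have hle : heatWeight p a α t j ≤ a * t * ((p : ℝ) ^ α * eigenvalue p α j) := by
      rw [← eigenvalue_sub_one]
      exact (sub_le_sub_right (heatFactor_le_one ha ht j) _).trans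
        (one_sub_heatFactor_le p a α t (j - 1))
    refine le_add_of_nonneg_of_le hw ((mul_le_mul_of_nonneg_right hle (by positivity)).trans_eq ?_)
    rw [indicator_of_mem (mem_Ioi.2 hj), div_zpow, eigenvalue, zpow_neg]
    ring
  · rw [indicator_of_notMem (by simpa using hj), mul_zero, add_zero]
    exact mul_le_of_le_one_right hw (zpow_le_one_of_nonpos₀ hr (not_lt.1 hj))

theorem exists_summable_heatWeight_mul_zpow_le {r T : ℝ} (ha : 0 < a) (hα : 0 < α) (hr : 1 ≤ r)
    (hrα : r < (p : ℝ) ^ α) (hT : 0 ≤ T) : ∃ M : ℝ, 0 ≤ M ∧ ∀ t ∈ Ioc 0 T,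
      Summable (fun j => heatWeight p a α t j * r ^ j) ∧
        ∑' j, heatWeight p a α t j * r ^ j ≤ M := by
  have hQ : 0 < (p : ℝ) ^ α := Real.rpow_pos_of_pos (prime_cast_pos p) α
  have hr0 : 0 < r := one_pos.trans_le hr
  set G := (Ioi 0).indicator fun j : ℤ => (r / (p : ℝ) ^ α) ^ j
  have hG : Summable G := summable_indicator_Ioi_zpow (div_pos hr0 hQ) ((div_lt_one hQ).2 hrα) 0
  have hG0 : 0 ≤ ∑' j, G j := tsum_nonneg (indicator_nonneg fun j _ => by positivity)
  refine ⟨1 + a * T * (p : ℝ) ^ α * ∑' j, G j, by positivity, fun t ht => ?_⟩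
  have hbound := (hasSum_heatWeight (p := p) ha hα ht.1).add
    (hG.hasSum.mul_left (a * t * (p : ℝ) ^ α))
  have hle := heatWeight_mul_zpow_le (p := p) ha.le hα.le hr ht.1.le
  have hsum : Summable fun j => heatWeight p a α t j * r ^ j :=
    hbound.summable.of_nonneg_of_le
      (fun j => mul_nonneg (heatWeight_nonneg ha.le hα.le ht.1.le j) (by positivity)) hle
  refine ⟨hsum, (hasSum_le hle hsum.hasSum hbound).trans ?_⟩
  gcongr
  exact ht.2

theorem summable_heatWeight_mul_zpow_neg {V : ℝ} (ha : 0 < a) (hα : 0 < α) (hV : 1 ≤ V)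
    (ht : 0 < t) : Summable fun j => heatWeight p a α t j * V ^ (-j) := by
  have hQ : 1 < (p : ℝ) ^ α := Real.one_lt_rpow (one_lt_prime_cast p) hα
  have hV0 : 0 < V := one_pos.trans_le hV
  obtain ⟨k, hk⟩ := pow_unbounded_of_one_lt V hQ
  have hq : 0 < ((p : ℝ) ^ α) ^ k := hV0.trans hk
  set c : ℝ := k.factorial / (a * t) ^ k
  have hgeom := ((Equiv.neg ℤ).summable_iff.2 (summable_indicator_Ioi_zpow
    (div_pos hV0 hq) ((div_lt_one hq).2 hk) 0)).mul_left c
  refine ((hasSum_heatWeight (p := p) ha hα ht).summable.add hgeom).of_nonneg_of_le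
    (fun j => mul_nonneg (heatWeight_nonneg ha.le hα.le ht.le j) (by positivity)) fun j => ?_
  have hw := heatWeight_nonneg (p := p) ha.le hα.le ht.le j
  by_cases hj : j < 0
  · refine le_add_of_nonneg_of_le hw ?_
    have hle : heatWeight p a α t j ≤ c * (((p : ℝ) ^ α) ^ k) ^ j :=
      (sub_le_self _ (Real.exp_pos _).le).trans (heatFactor_le_pow ha ht j k)
    refine (mul_le_mul_of_nonneg_right hle (by positivity)).trans_eq ?_
    rw [Function.comp_apply, Equiv.neg_apply, indicator_of_mem (mem_Ioi.2 (neg_pos.2 hj)),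
      mul_assoc, div_zpow, zpow_neg (_ ^ k), div_inv_eq_mul, mul_comm (V ^ (-j))]
  · rw [Function.comp_apply, Equiv.neg_apply, indicator_of_notMem (by simpa using hj), mul_zero,
      add_zero]
    exact mul_le_of_le_one_right hw (zpow_le_one_of_nonpos₀ hV (by lia))

end HeatWeights

section HeatKernel

variable {a α t : ℝ}

theorem hasSum_exp_neg_norm_rpow (ha : 0 < a) (hα : 0 < α) (ht : 0 < t) (ξ : Fin n → ℚ_[p]) :
    HasSum (fun j => (padicBall p n (-j) : Set (Fin n → ℚ_[p])).indicator
      (fun _ => (heatWeight p a α t j : ℂ)) ξ) ((Real.exp (-(a * t * ‖ξ‖ ^ α)) : ℝ) : ℂ) := by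
  rcases eq_or_ne ξ 0 with rfl | hξ
  · rw [norm_zero, Real.zero_rpow hα.ne', mul_zero, neg_zero, Real.exp_zero]
    refine (Complex.hasSum_ofReal.2 (hasSum_heatWeight (p := p) ha hα ht)).congr_fun fun j => ?_
    exact indicator_of_mem (zero_mem (padicBall p n (-j))) _
  · obtain ⟨m, hm⟩ := exists_norm_eq_zpow hξ
    have hvalue : Real.exp (-(a * t * ‖ξ‖ ^ α)) = heatFactor p a α t (-m) - 0 := by
      rw [sub_zero, heatFactor, eigenvalue, neg_neg, hm, Real.rpow_zpow_comm
        (prime_cast_pos p).le, mul_right_comm]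
    rw [hvalue]
    refine (Complex.hasSum_ofReal.2 (hasSum_indicator_Iic_sub
      (heatFactor_monotone ha.le hα.le ht.le) (tendsto_heatFactor_atBot ha hα ht)
      (-m))).congr_fun fun j => ?_
    by_cases hj : j ≤ -m
    · rw [indicator_of_mem ((mem_padicBall_iff_le hm).2 (by lia)), indicator_of_mem (mem_Iic.2 hj)]
      rfl
    · rw [indicator_of_notMem (mt (mem_padicBall_iff_le hm).1 (by lia)),
        indicator_of_notMem (mt mem_Iic.1 hj), Complex.ofReal_zero]

theorem hasSum_heatKernel (ha : 0 < a) (hα : 0 < α) (ht : 0 < t) (x : Fin n → ℚ_[p]) :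
    HasSum (fun j => (padicBall p n j : Set (Fin n → ℚ_[p])).indicator
      (fun _ => ((heatWeight p a α t j * ((p : ℝ) ^ n) ^ (-j) : ℝ) : ℂ)) x)
      (heatKernel a α x t) := by
  have hV : (1 : ℝ) ≤ (p : ℝ) ^ n := one_le_pow₀ (one_lt_prime_cast p).le
  have hmain := (integrable_and_hasSum_integral_mul_of_hasSum_indicator (μ := volume)
    (s := fun j => (padicBall p n (-j) : Set (Fin n → ℚ_[p]))) (κ := heatWeight p a α t)
    (b := 1) (h := fun ξ => stdChar (∑ i, x i * ξ i))
    (fun j => measurableSet_padicBall _) (fun j => volume_padicBall_ne_top _)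
    (heatWeight_nonneg ha.le hα.le ht.le) (continuous_stdChar_sum x).aestronglyMeasurable
    (fun j ξ _ => (norm_stdChar _).le)
    (by simpa only [measureReal_padicBall, Pi.one_apply, mul_one] using
      summable_heatWeight_mul_zpow_neg ha hα hV ht)
    fun ξ _ => hasSum_exp_neg_norm_rpow ha hα ht ξ).2
  simp only [mul_comm ((Real.exp _ : ℝ) : ℂ)] at hmain
  refine hmain.congr_fun fun j => ?_
  have hvol : ((p : ℝ) ^ n) ^ (-j) ≠ 0 := by positivity
  rw [setAverage_eq, setIntegral_stdChar, measureReal_padicBall, smul_smul, mul_assoc,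
    mul_inv_cancel₀ hvol, mul_one]
  by_cases hx : x ∈ (padicBall p n j : Set (Fin n → ℚ_[p]))
  · rw [indicator_of_mem hx, indicator_of_mem hx, Complex.real_smul, Complex.ofReal_mul]
  · rw [indicator_of_notMem hx, indicator_of_notMem hx, smul_zero]

variable {lam C T : ℝ} {l : (Fin n → ℚ_[p]) → ℤ} {g : (Fin n → ℚ_[p]) → ℂ}

theorem summable_heatWeight_mul_rpow_zpow (ha : 0 < a) (hlam : 0 ≤ lam) (hlamα : lam < α)
    (ht : 0 < t) : Summable fun j => heatWeight p a α t j * ((p : ℝ) ^ lam) ^ j := by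
  have hp := one_lt_prime_cast p
  obtain ⟨M, -, hM⟩ := exists_summable_heatWeight_mul_zpow_le (p := p) ha
    (hlam.trans_lt hlamα) (Real.one_le_rpow hp.le hlam)
    (Real.rpow_lt_rpow_of_exponent_lt hp hlamα) ht.le
  exact (hM t ⟨ht, le_rfl⟩).1

theorem integrable_and_hasSum_heatKernel_mul (ha : 0 < a) (hg : MemMWith lam C l g)
    (hlam : 0 ≤ lam) (hlamα : lam < α) (ht : 0 < t) (x : Fin n → ℚ_[p]) :
    Integrable (fun ξ => heatKernel a α (x - ξ) t * g ξ) ∧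
      HasSum (fun j => heatWeight p a α t j • ballAvg j g x)
        (∫ ξ, heatKernel a α (x - ξ) t * g ξ) := by
  have hα : 0 < α := hlam.trans_lt hlamα
  have hvol : ∀ j : ℤ, ((p : ℝ) ^ n) ^ (-j) * ((p : ℝ) ^ n) ^ j = 1 := fun j => by
    have hp := prime_cast_pos p
    rw [← zpow_add₀ (by positivity), neg_add_cancel, zpow_zero]
  have hcont : Continuous fun y => g (x - y) := by
    have := hg.continuous
    fun_prop
  have hmain := integrable_and_hasSum_integral_mul_of_hasSum_indicator (μ := volume)
    (s := fun j => (padicBall p n j : Set (Fin n → ℚ_[p])))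
    (κ := fun j => heatWeight p a α t j * ((p : ℝ) ^ n) ^ (-j))
    (b := fun j => C * (1 + ‖x‖ ^ lam + ((p : ℝ) ^ lam) ^ j)) (h := fun y => g (x - y))
    (fun j => measurableSet_padicBall j) (fun j => volume_padicBall_ne_top j)
    (fun j => mul_nonneg (heatWeight_nonneg ha.le hα.le ht.le j) (by positivity))
    hcont.aestronglyMeasurable (fun j y hy => hg.norm_sub_le hlam x hy) ?_
    fun y _ => hasSum_heatKernel ha hα ht y
  · simp only [measureReal_padicBall, mul_assoc, hvol, mul_one] at hmain
    refine ⟨?_, ?_⟩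
    · simpa only [sub_sub_cancel] using hmain.1.comp_sub_left x
    · rw [← integral_sub_left_eq_self _ volume x]
      simpa only [sub_sub_cancel] using! hmain.2
  · simp only [measureReal_padicBall, mul_assoc, hvol, one_mul]
    refine ((((hasSum_heatWeight (p := p) ha hα ht).summable.mul_left (1 + ‖x‖ ^ lam)).add
      (summable_heatWeight_mul_rpow_zpow (p := p) ha hlam hlamα ht)).mul_left C).congr fun j => ?_
    ring

end HeatKernel

section HeatFlow

/-- The heat semigroup at time `t` applied to `g`, written so that it also makes sense at `t = 0`;
for `t > 0` it is the convolution of `g` with the heat kernel. -/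
def heatFlow (a α t : ℝ) (g : (Fin n → ℚ_[p]) → ℂ) (x : Fin n → ℚ_[p]) : ℂ :=
  g x + ∑' i, (heatFactor p a α t i - 1) • ballDiff i g x

variable {a α lam C t T : ℝ} {l : (Fin n → ℚ_[p]) → ℤ} {g : (Fin n → ℚ_[p]) → ℂ}

theorem heatFlow_zero (a α : ℝ) (g : (Fin n → ℚ_[p]) → ℂ) : heatFlow a α 0 g = g := by
  funext x
  simp [heatFlow, heatFactor]

theorem ConstAt.heatFlow {m : ℤ} {x : Fin n → ℚ_[p]} (h : ConstAt m g x) (a α t : ℝ) :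
    ConstAt m (PadicHeat.heatFlow a α t g) x := fun y hy => by
  simp only [PadicHeat.heatFlow, h y hy, fun i => h.ballDiff i y hy]

theorem MemMWith.norm_heatFactor_sub_one_smul_ballDiff_le (hg : MemMWith lam C l g)
    (hlam : 0 ≤ lam) (ha : 0 ≤ a) (ht : t ∈ Icc 0 T) (i : ℤ) (x : Fin n → ℚ_[p]) :
    ‖(heatFactor p a α t i - 1) • PadicHeat.ballDiff i g x‖ ≤
      a * T * (eigenvalue p α i * oscBound p lam C ‖x‖ (l x) (i + 1)) := by
  have he := eigenvalue_pos (p := p) α i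
  rw [norm_smul, ← mul_assoc]
  refine mul_le_mul ((norm_heatFactor_sub_one_le ha ht.1 i).trans ?_)
    (hg.norm_ballDiff_le hlam i x) (norm_nonneg _)
    (mul_nonneg (mul_nonneg ha (ht.1.trans ht.2)) he.le)
  gcongr
  exact ht.2

theorem MemMWith.summable_heatFactor_sub_one_smul_ballDiff (hg : MemMWith lam C l g)
    (ha : 0 ≤ a) (hlam : 0 ≤ lam) (hlamα : lam < α) (ht : 0 ≤ t) (x : Fin n → ℚ_[p]) :
    Summable fun i => (heatFactor p a α t i - 1) • PadicHeat.ballDiff i g x :=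
  .of_norm_bounded ((summable_eigenvalue_mul_oscBound_add_one hlam hlamα C ‖x‖ (l x)).mul_left
    (a * t)) fun i => hg.norm_heatFactor_sub_one_smul_ballDiff_le hlam ha ⟨ht, le_rfl⟩ i x

theorem hasSum_heatWeight_smul_ballAvg (hg : MemMWith lam C l g) (ha : 0 < a) (hlam : 0 ≤ lam)
    (hlamα : lam < α) (ht : 0 < t) (x : Fin n → ℚ_[p]) :
    HasSum (fun j => heatWeight p a α t j • ballAvg j g x) (heatFlow a α t g x) := by
  have hα : 0 < α := hlam.trans_lt hlamα
  have hsum := (hg.summable_heatFactor_sub_one_smul_ballDiff ha.le hlam hlamα ht.le x).norm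
  have habel := hasSum_sub_smul_sum_Ico (l := l x) (d := fun i => ballDiff i g x)
    (heatFactor_monotone ha.le hα.le ht.le) (tendsto_heatFactor_atTop hα a t)
    (fun i hi => (hg.constAt x).ballDiff_eq_zero hi) (hsum.congr fun i => by
      rw [norm_smul, norm_sub_rev,
        Real.norm_of_nonneg (sub_nonneg.2 (heatFactor_le_one ha.le ht.le i))])
  have hmain := ((hasSum_heatWeight (p := p) ha hα ht).smul_const (g x)).sub habel
  have hflow : heatFlow a α t g x =
      (1 : ℝ) • g x - ∑' i, (1 - heatFactor p a α t i) • ballDiff i g x := by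
    rw [heatFlow, one_smul, sub_eq_add_neg, ← tsum_neg]
    simp only [← neg_smul, neg_sub]
  rw [hflow]
  refine hmain.congr_fun fun j => ?_
  rw [← heatWeight, ← smul_sub, sub_eq_add_neg,
    ← sub_eq_iff_eq_add'.1 ((hg.constAt x).ballAvg_sub_self j)]

theorem integral_heatKernel_mul (hg : MemMWith lam C l g) (ha : 0 < a) (hlam : 0 ≤ lam)
    (hlamα : lam < α) (ht : 0 < t) (x : Fin n → ℚ_[p]) :
    ∫ ξ, heatKernel a α (x - ξ) t * g ξ = heatFlow a α t g x :=
  (integrable_and_hasSum_heatKernel_mul ha hg hlam hlamα ht x).2.unique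
    (hasSum_heatWeight_smul_ballAvg hg ha hlam hlamα ht x)

theorem exists_memMWith_heatFlow (p n : ℕ) [Fact p.Prime] (ha : 0 < a) (hlam : 0 ≤ lam)
    (hlamα : lam < α) (hT : 0 ≤ T) : ∃ M : ℝ, 0 ≤ M ∧ ∀ t ∈ Icc 0 T,
      ∀ {C : ℝ} {l : (Fin n → ℚ_[p]) → ℤ} {g : (Fin n → ℚ_[p]) → ℂ},
        MemMWith lam C l g → MemMWith lam (C * M) l (heatFlow a α t g) := by
  have hp := one_lt_prime_cast p
  have hα : 0 < α := hlam.trans_lt hlamα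
  obtain ⟨M, hM0, hM⟩ := exists_summable_heatWeight_mul_zpow_le (p := p) ha hα
    (Real.one_le_rpow hp.le hlam) (Real.rpow_lt_rpow_of_exponent_lt hp hlamα) hT
  refine ⟨1 + M, by positivity, fun t ht C l g hg =>
    ⟨fun x => (hg.constAt x).heatFlow a α t, fun x => ?_⟩⟩
  have hC := hg.nonneg
  have hx : 0 ≤ ‖x‖ ^ lam := by positivity
  rcases ht.1.eq_or_lt with rfl | ht0
  · rw [heatFlow_zero]
    refine (hg.norm_le x).trans ?_
    gcongr
    exact le_mul_of_one_le_right hC (by linarith)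
  obtain ⟨hsum, hle⟩ := hM t ⟨ht0, ht.2⟩
  have hbound := (((hasSum_heatWeight (p := p) ha hα ht0).mul_left (1 + ‖x‖ ^ lam)).add
    hsum.hasSum).mul_left C
  calc ‖heatFlow a α t g x‖
      ≤ C * ((1 + ‖x‖ ^ lam) * 1 + ∑' j, heatWeight p a α t j * ((p : ℝ) ^ lam) ^ j) := by
        rw [← (hasSum_heatWeight_smul_ballAvg hg ha hlam hlamα ht0 x).tsum_eq]
        refine tsum_of_norm_bounded hbound fun j => ?_
        have hw := heatWeight_nonneg (p := p) ha.le hα.le ht0.le j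
        rw [norm_smul, Real.norm_of_nonneg hw]
        refine (mul_le_mul_of_nonneg_left (hg.norm_ballAvg_le hlam j x) hw).trans_eq ?_
        ring
    _ ≤ C * ((1 + ‖x‖ ^ lam) * 1 + (1 + ‖x‖ ^ lam) * M) := by
        gcongr
        exact hle.trans (le_mul_of_one_le_left hM0 (by linarith))
    _ = C * (1 + M) * (1 + ‖x‖ ^ lam) := by ring

theorem ballDiff_heatFlow (hg : MemMWith lam C l g) (ha : 0 ≤ a) (hlam : 0 ≤ lam)
    (hlamα : lam < α) (ht : 0 ≤ t) (i : ℤ) (x : Fin n → ℚ_[p]) :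
    ballDiff i (heatFlow a α t g) x = heatFactor p a α t i • ballDiff i g x := by
  have hδ : ∀ k x, ConstAt (l x) (ballDiff k g) x := fun k x => (hg.constAt x).ballDiff k
  have hsum := fun z => (hg.summable_heatFactor_sub_one_smul_ballDiff ha hlam hlamα ht z).hasSum
  have hterm (k : ℤ) : ballDiff i (fun z => (heatFactor p a α t k - 1) • ballDiff k g z) x =
      if k = i then (heatFactor p a α t i - 1) • ballDiff i g x else 0 := by
    rw [ballDiff_smul (hδ k), ballDiff_ballDiff hg.continuous]
    split_ifs with hik hki hki
    · rw [hik]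
    · exact absurd hik.symm hki
    · exact absurd hki.symm hik
    · exact smul_zero _
  have hseries : HasSum
      (fun k => ballDiff i (fun z => (heatFactor p a α t k - 1) • ballDiff k g z) x)
      (ballDiff i (fun z => ∑' k, (heatFactor p a α t k - 1) • ballDiff k g z) x) :=
    hasSum_ballDiff
      (fun k x y hy => congrArg ((heatFactor p a α t k - 1) • ·) (hδ k x y hy)) hsum i x
  have hconst : ∀ x, ConstAt (l x)
      (fun z => ∑' k, (heatFactor p a α t k - 1) • ballDiff k g z) x := fun x y hy =>
    tsum_congr fun k => congrArg _ (hδ k x y hy)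
  simp only [hterm] at hseries
  calc ballDiff i (heatFlow a α t g) x
      = ballDiff i g x + (heatFactor p a α t i - 1) • ballDiff i g x := by
        rw [← hseries.unique (hasSum_ite_eq i _)]
        exact ballDiff_add hg.constAt hconst i x
    _ = heatFactor p a α t i • ballDiff i g x := by rw [sub_smul, one_smul, add_sub_cancel]

end HeatFlow

section Modes

variable {E : Type*} [NormedAddCommGroup E] {k β s t T : ℝ} {c : E} {b : ℝ → E}

theorem intervalIntegrable_of_continuousOn_Ioo (hst : s ≤ t) (hb : ContinuousOn b (Ioo s t))
    (hβ : ∀ τ ∈ Ioo s t, ‖b τ‖ ≤ β) : IntervalIntegrable b volume s t := by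
  rw [intervalIntegrable_iff_integrableOn_Ioo_of_le hst]
  exact .of_bound measure_Ioo_lt_top (hb.aestronglyMeasurable measurableSet_Ioo) β
    ((ae_restrict_iff' measurableSet_Ioo).2 (.of_forall hβ))

variable [NormedSpace ℝ E]

/-- The solution of `y' + k y = b`, `y(0) = c`, given by Duhamel's formula. -/
def mode (k : ℝ) (c : E) (b : ℝ → E) (t : ℝ) : E :=
  Real.exp (-(k * t)) • c + ∫ τ in (0 : ℝ)..t, Real.exp (-(k * (t - τ))) • b τ

/-- The difference `mode k c b - mode 0 c b`. It is of order `k`, and so can be summed over the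
components of an unbounded function. -/
def modeDev (k : ℝ) (c : E) (b : ℝ → E) (t : ℝ) : E :=
  (Real.exp (-(k * t)) - 1) • c + ∫ τ in (0 : ℝ)..t, (Real.exp (-(k * (t - τ))) - 1) • b τ

theorem mode_eq_exp_smul (k : ℝ) (c : E) (b : ℝ → E) (t : ℝ) :
    mode k c b t = Real.exp (-(k * t)) • (c + ∫ τ in (0 : ℝ)..t, Real.exp (k * τ) • b τ) := by
  rw [mode, smul_add, ← intervalIntegral.integral_smul]
  congr 2 with τ
  rw [smul_smul, ← Real.exp_add]
  ring_nf

theorem modeDev_eq_sub (k : ℝ) (c : E) (hb : IntervalIntegrable b volume 0 t) :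
    modeDev k c b t = mode k c b t - mode 0 c b t := by
  have hexp : IntervalIntegrable (fun τ => Real.exp (-(k * (t - τ))) • b τ) volume 0 t :=
    hb.continuousOn_smul (by fun_prop)
  simp only [modeDev, mode, sub_smul, one_smul, zero_mul, neg_zero, Real.exp_zero]
  rw [intervalIntegral.integral_sub hexp hb]
  abel

theorem norm_mode_le (hk : 0 ≤ k) (ht : 0 ≤ t) (hc : ‖c‖ ≤ β) (hβ : ∀ τ, 0 < τ → ‖b τ‖ ≤ β) :
    ‖mode k c b t‖ ≤ (1 + t) * β := by
  have hexp : ∀ {s : ℝ} {y : E}, 0 ≤ s → ‖y‖ ≤ β → ‖Real.exp (-(k * s)) • y‖ ≤ β :=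
    fun hs hy => by
      rw [norm_smul, Real.norm_of_nonneg (Real.exp_pos _).le]
      exact (mul_le_of_le_one_left (norm_nonneg _)
        (Real.exp_le_one_iff.2 (neg_nonpos.2 (mul_nonneg hk hs)))).trans hy
  have hint := intervalIntegral.norm_integral_le_of_norm_le_const (a := 0) (b := t)
    (f := fun τ => Real.exp (-(k * (t - τ))) • b τ) fun τ hτ => by
      rw [uIoc_of_le ht] at hτ
      exact hexp (sub_nonneg.2 hτ.2) (hβ τ hτ.1)
  rw [sub_zero, abs_of_nonneg ht] at hint
  rw [mode]
  linarith [norm_add_le_of_le (hexp ht hc) hint]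

theorem norm_modeDev_le (hk : 0 ≤ k) (ht : t ∈ Icc 0 T) (hc : ‖c‖ ≤ β)
    (hβ : ∀ τ, 0 < τ → ‖b τ‖ ≤ β) : ‖modeDev k c b t‖ ≤ k * (T * (1 + T) * β) := by
  have hexp : ∀ {s : ℝ} {y : E}, s ∈ Icc 0 T → ‖y‖ ≤ β →
      ‖(Real.exp (-(k * s)) - 1) • y‖ ≤ k * T * β := fun {s y} hs hy => by
    have hks : 0 ≤ k * s := mul_nonneg hk hs.1
    have hle : ‖Real.exp (-(k * s)) - 1‖ ≤ k * T := by
      rw [norm_sub_rev, Real.norm_of_nonneg (sub_nonneg.2 (Real.exp_le_one_iff.2 (by linarith)))]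
      linarith [Real.add_one_le_exp (-(k * s)), mul_le_mul_of_nonneg_left hs.2 hk]
    rw [norm_smul]
    exact mul_le_mul hle hy (norm_nonneg _) ((norm_nonneg _).trans hle)
  have hint := intervalIntegral.norm_integral_le_of_norm_le_const (a := 0) (b := t)
    (f := fun τ => (Real.exp (-(k * (t - τ))) - 1) • b τ) fun τ hτ => by
      rw [uIoc_of_le ht.1] at hτ
      exact hexp ⟨sub_nonneg.2 hτ.2, by linarith [hτ.1, ht.2]⟩ (hβ τ hτ.1)
  rw [sub_zero, abs_of_nonneg ht.1] at hint
  have hT : 0 ≤ T := ht.1.trans ht.2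
  have hβ0 : 0 ≤ k * T * β := mul_nonneg (mul_nonneg hk hT) ((norm_nonneg c).trans hc)
  refine (norm_add_le_of_le (hexp ht hc) hint).trans ?_
  linarith [mul_le_mul_of_nonneg_left ht.2 hβ0]

theorem continuousOn_mode (k : ℝ) (c : E) (hb : IntervalIntegrable b volume 0 T) (hT : 0 ≤ T) :
    ContinuousOn (mode k c b) (Icc 0 T) := by
  have hprim := intervalIntegral.continuousOn_primitive_interval'
    (hb.continuousOn_smul (f := fun τ => Real.exp (k * τ)) (by fun_prop)) left_mem_uIcc
  rw [uIcc_of_le hT] at hprim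
  rw [show mode k c b = _ from funext (mode_eq_exp_smul k c b)]
  exact (by fun_prop : Continuous fun u => Real.exp (-(k * u))).continuousOn.smul
    (continuousOn_const.add hprim)

theorem continuousOn_modeDev (k : ℝ) (c : E) (hb : IntervalIntegrable b volume 0 T) (hT : 0 ≤ T) :
    ContinuousOn (modeDev k c b) (Icc 0 T) :=
  ((continuousOn_mode k c hb hT).sub (continuousOn_mode 0 c hb hT)).congr fun t ht =>
    modeDev_eq_sub k c (hb.mono_set (by
      rw [uIcc_of_le hT, uIcc_of_le ht.1]
      exact Icc_subset_Icc_right ht.2))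

variable [CompleteSpace E]

theorem hasDerivAt_mode (k : ℝ) (c : E) (ht : 0 < t) (hb : ContinuousOn b (Ioi 0))
    (hint : IntervalIntegrable b volume 0 t) :
    HasDerivAt (mode k c b) (b t - k • mode k c b t) t := by
  have hcont : ContinuousOn (fun τ => Real.exp (k * τ) • b τ) (Ioi 0) :=
    (by fun_prop : Continuous fun τ => Real.exp (k * τ)).continuousOn.smul hb
  have hprim : HasDerivAt (fun u => ∫ τ in (0 : ℝ)..u, Real.exp (k * τ) • b τ)
      (Real.exp (k * t) • b t) t :=
    intervalIntegral.integral_hasDerivAt_right (hint.continuousOn_smul (by fun_prop))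
      (hcont.stronglyMeasurableAtFilter isOpen_Ioi t ht) (hcont.continuousAt (Ioi_mem_nhds ht))
  have hexp : HasDerivAt (fun u => Real.exp (-(k * u))) (Real.exp (-(k * t)) * -(k * 1)) t :=
    ((hasDerivAt_id t).const_mul k).neg.exp
  rw [mode_eq_exp_smul, show mode k c b = _ from funext (mode_eq_exp_smul k c b)]
  refine (hexp.smul (hprim.const_add c)).congr_deriv ?_
  rw [smul_smul (Real.exp (-(k * t))), ← Real.exp_add, neg_add_cancel, Real.exp_zero, one_smul,
    smul_smul, sub_eq_add_neg, ← neg_smul]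
  congr 2
  ring

theorem hasDerivAt_modeDev (k : ℝ) (c : E) (ht : 0 < t) (hb : ContinuousOn b (Ioi 0))
    (hint : ∀ s, 0 < s → IntervalIntegrable b volume 0 s) :
    HasDerivAt (modeDev k c b) (-(k • mode k c b t)) t := by
  have hsub : modeDev k c b =ᶠ[𝓝 t] fun s => mode k c b s - mode 0 c b s :=
    eventually_of_mem (Ioi_mem_nhds ht) fun s hs => modeDev_eq_sub k c (hint s hs)
  refine (((hasDerivAt_mode k c ht hb (hint t ht)).sub
    (hasDerivAt_mode 0 c ht hb (hint t ht))).congr_of_eventuallyEq hsub).congr_deriv ?_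
  rw [zero_smul]
  abel

end Modes

section Duhamel

/-- A source term on `(0, ∞)`: continuous in time, and in `𝔐_λ` with constants independent of
time. -/
structure IsSource (lam C : ℝ) (l : (Fin n → ℚ_[p]) → ℤ) (f : (Fin n → ℚ_[p]) → ℝ → ℂ) : Prop where
  memMWith : ∀ t, 0 < t → MemMWith lam C l fun z => f z t
  continuousOn : ∀ x, ContinuousOn (f x) (Ioi 0)

/-- Duhamel's formula for the solution with initial value `φ` and source term `f`. -/
def heatSolution (a α : ℝ) (φ : (Fin n → ℚ_[p]) → ℂ) (f : (Fin n → ℚ_[p]) → ℝ → ℂ)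
    (x : Fin n → ℚ_[p]) (t : ℝ) : ℂ :=
  heatFlow a α t φ x + ∫ τ in (0 : ℝ)..t, heatFlow a α (t - τ) (fun z => f z τ) x

variable {a α lam C t T : ℝ} {l : (Fin n → ℚ_[p]) → ℤ} {φ : (Fin n → ℚ_[p]) → ℂ}
  {f : (Fin n → ℚ_[p]) → ℝ → ℂ}

theorem heatSolution_zero (a α : ℝ) (φ : (Fin n → ℚ_[p]) → ℂ) (f : (Fin n → ℚ_[p]) → ℝ → ℂ)
    (x : Fin n → ℚ_[p]) : heatSolution a α φ f x 0 = φ x := by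
  rw [heatSolution, heatFlow_zero, intervalIntegral.integral_same, add_zero]

theorem ConstAt.heatSolution {m : ℤ} {x : Fin n → ℚ_[p]} (hφ : ConstAt m φ x)
    (hf : ∀ τ, 0 < τ → ConstAt m (fun z => f z τ) x) (a α : ℝ) (ht : 0 ≤ t) :
    ConstAt m (fun z => PadicHeat.heatSolution a α φ f z t) x := by
  have hint : ConstAt m (fun z => ∫ τ in (0 : ℝ)..t,
      PadicHeat.heatFlow a α (t - τ) (fun z => f z τ) z) x :=
    .intervalIntegral fun τ hτ => (hf τ (uIoo_of_le ht ▸ hτ).1).heatFlow a α (t - τ)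
  exact fun y hy => congrArg₂ (· + ·) (hφ.heatFlow a α t y hy) (hint y hy)

theorem continuous_heatFactor_const_sub (p : ℕ) (a α t : ℝ) (i : ℤ) :
    Continuous fun τ => heatFactor p a α (t - τ) i := by
  unfold heatFactor
  fun_prop

theorem summable_mul_eigenvalue_mul_mul_oscBound (p : ℕ) [Fact p.Prime] (hlam : 0 ≤ lam)
    (hlamα : lam < α) (a M C r : ℝ) (m : ℤ) :
    Summable fun i => a * eigenvalue p α i * (M * oscBound p lam C r m (i + 1)) :=
  ((summable_eigenvalue_mul_oscBound_add_one (p := p) hlam hlamα C r m).mul_left (a * M)).congr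
    fun i => by ring

namespace IsSource

theorem continuousOn_ballDiff (hf : IsSource lam C l f) (i : ℤ) (x : Fin n → ℚ_[p]) :
    ContinuousOn (fun τ => ballDiff i (fun z => f z τ) x) (Ioi 0) := by
  obtain ⟨ι, _, c, z, hz⟩ := exists_ballDiff_eq_sum l i x
  refine ContinuousOn.congr (f := fun τ => ∑ k, c k • f (z k) τ) ?_ fun τ hτ =>
    hz _ (hf.memMWith τ hτ).constAt
  exact continuousOn_finsetSum _ fun k _ => (hf.continuousOn (z k)).const_smul (c k)

theorem norm_ballDiff_le (hf : IsSource lam C l f) (hlam : 0 ≤ lam) (i : ℤ)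
    (x : Fin n → ℚ_[p]) (τ : ℝ) (hτ : 0 < τ) :
    ‖ballDiff i (fun z => f z τ) x‖ ≤ oscBound p lam C ‖x‖ (l x) (i + 1) :=
  (hf.memMWith τ hτ).norm_ballDiff_le hlam i x

theorem intervalIntegrable (hf : IsSource lam C l f) (ht : 0 ≤ t) (x : Fin n → ℚ_[p]) :
    IntervalIntegrable (f x) volume 0 t :=
  intervalIntegrable_of_continuousOn_Ioo ht ((hf.continuousOn x).mono Ioo_subset_Ioi_self)
    fun τ hτ => (hf.memMWith τ hτ.1).norm_le x

theorem intervalIntegrable_ballDiff (hf : IsSource lam C l f) (hlam : 0 ≤ lam) (ht : 0 ≤ t)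
    (i : ℤ) (x : Fin n → ℚ_[p]) :
    IntervalIntegrable (fun τ => ballDiff i (fun z => f z τ) x) volume 0 t :=
  intervalIntegrable_of_continuousOn_Ioo ht
    ((hf.continuousOn_ballDiff i x).mono Ioo_subset_Ioi_self)
    fun τ hτ => hf.norm_ballDiff_le hlam i x τ hτ.1

theorem continuousOn_heatFlow (hf : IsSource lam C l f) (ha : 0 ≤ a) (hlam : 0 ≤ lam)
    (hlamα : lam < α) (x : Fin n → ℚ_[p]) :
    ContinuousOn (fun τ => heatFlow a α (t - τ) (fun z => f z τ) x) (Ioo 0 t) := by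
  refine ((hf.continuousOn x).mono Ioo_subset_Ioi_self).add (continuousOn_tsum (fun i => ?_)
    ((summable_eigenvalue_mul_oscBound_add_one hlam hlamα C ‖x‖ (l x)).mul_left (a * t))
    fun i τ hτ => (hf.memMWith τ hτ.1).norm_heatFactor_sub_one_smul_ballDiff_le hlam ha
      ⟨by linarith [hτ.2], by linarith [hτ.1]⟩ i x)
  exact ((continuous_heatFactor_const_sub p a α t i).sub continuous_const).continuousOn.smul
    ((hf.continuousOn_ballDiff i x).mono Ioo_subset_Ioi_self)

theorem intervalIntegrable_heatFlow (hf : IsSource lam C l f) (ha : 0 < a) (hlam : 0 ≤ lam)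
    (hlamα : lam < α) (ht : 0 ≤ t) (x : Fin n → ℚ_[p]) :
    IntervalIntegrable (fun τ => heatFlow a α (t - τ) (fun z => f z τ) x) volume 0 t := by
  obtain ⟨M, -, hM⟩ := exists_memMWith_heatFlow p n ha hlam hlamα ht
  exact intervalIntegrable_of_continuousOn_Ioo ht (hf.continuousOn_heatFlow ha.le hlam hlamα x)
    fun τ hτ => (hM (t - τ) ⟨by linarith [hτ.2], by linarith [hτ.1]⟩ (hf.memMWith τ hτ.1)).norm_le x

theorem hasSum_integral_heatFlow_sub (hf : IsSource lam C l f) (ha : 0 ≤ a) (hlam : 0 ≤ lam)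
    (hlamα : lam < α) (ht : 0 ≤ t) (x : Fin n → ℚ_[p]) :
    HasSum (fun i => ∫ τ in (0 : ℝ)..t,
        (heatFactor p a α (t - τ) i - 1) • ballDiff i (fun z => f z τ) x)
      (∫ τ in (0 : ℝ)..t, (heatFlow a α (t - τ) (fun z => f z τ) x - f x τ)) := by
  refine intervalIntegral.hasSum_integral_of_dominated_convergence
    (fun i _ => a * t * (eigenvalue p α i * oscBound p lam C ‖x‖ (l x) (i + 1)))
    (fun i => ?_) (fun i => .of_forall fun τ hτ => ?_) (.of_forall fun τ hτ => ?_)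
    intervalIntegrable_const (.of_forall fun τ hτ => ?_)
  all_goals rw [uIoc_of_le ht] at *
  · exact ((continuous_heatFactor_const_sub p a α t i).sub continuous_const).continuousOn.smul
      ((hf.continuousOn_ballDiff i x).mono Ioc_subset_Ioi_self) |>.aestronglyMeasurable
      measurableSet_Ioc
  · exact (hf.memMWith τ hτ.1).norm_heatFactor_sub_one_smul_ballDiff_le hlam ha
      ⟨sub_nonneg.2 hτ.2, by linarith [hτ.1]⟩ i x
  · exact (summable_eigenvalue_mul_oscBound_add_one hlam hlamα C ‖x‖ (l x)).mul_left (a * t)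
  · simpa only [heatFlow, add_sub_cancel_left] using
      ((hf.memMWith τ hτ.1).summable_heatFactor_sub_one_smul_ballDiff ha hlam hlamα
        (sub_nonneg.2 hτ.2) x).hasSum

theorem heatSolution_eq_tsum (hf : IsSource lam C l f) (hφ : MemMWith lam C l φ) (ha : 0 < a)
    (hlam : 0 ≤ lam) (hlamα : lam < α) (ht : 0 ≤ t) (x : Fin n → ℚ_[p]) :
    heatSolution a α φ f x t = mode 0 (φ x) (f x) t + ∑' i, modeDev (a * eigenvalue p α i)
      (ballDiff i φ x) (fun τ => ballDiff i (fun z => f z τ) x) t := by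
  have hsum := (hφ.summable_heatFactor_sub_one_smul_ballDiff ha.le hlam hlamα ht x).hasSum.add
    (hf.hasSum_integral_heatFlow_sub ha.le hlam hlamα ht x)
  rw [intervalIntegral.integral_sub (hf.intervalIntegrable_heatFlow ha hlam hlamα ht x)
    (hf.intervalIntegrable ht x)] at hsum
  simp only [modeDev, heatFactor] at hsum ⊢
  rw [hsum.tsum_eq, heatSolution, mode, heatFlow]
  simp only [zero_mul, neg_zero, Real.exp_zero, one_smul, heatFactor]
  ring

theorem ballDiff_heatSolution (hf : IsSource lam C l f) (hφ : MemMWith lam C l φ) (ha : 0 < a)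
    (hlam : 0 ≤ lam) (hlamα : lam < α) (ht : 0 ≤ t) (i : ℤ) (x : Fin n → ℚ_[p]) :
    ballDiff i (fun z => heatSolution a α φ f z t) x = mode (a * eigenvalue p α i)
      (ballDiff i φ x) (fun τ => ballDiff i (fun z => f z τ) x) t := by
  have hG : ∀ τ ∈ uIoo 0 t, ∀ x, ConstAt (l x) (heatFlow a α (t - τ) fun z => f z τ) x :=
    fun τ hτ x => ((hf.memMWith τ (uIoo_of_le ht ▸ hτ).1).constAt x).heatFlow a α (t - τ)
  calc _ = ballDiff i (heatFlow a α t φ) x +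
        ballDiff i (fun z => ∫ τ in (0 : ℝ)..t, heatFlow a α (t - τ) (fun z => f z τ) z) x :=
        ballDiff_add (fun x => (hφ.constAt x).heatFlow a α t)
          (fun x => .intervalIntegral fun τ hτ => hG τ hτ x) i x
    _ = heatFactor p a α t i • ballDiff i φ x + ∫ τ in (0 : ℝ)..t,
        heatFactor p a α (t - τ) i • ballDiff i (fun z => f z τ) x := by
        rw [ballDiff_heatFlow hφ ha.le hlam hlamα ht, ballDiff_intervalIntegral hG
          (hf.intervalIntegrable_heatFlow ha hlam hlamα ht)]
        refine congrArg _ (intervalIntegral.integral_congr_uIoo fun τ hτ => ?_)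
        rw [uIoo_of_le ht] at hτ
        exact ballDiff_heatFlow (hf.memMWith τ hτ.1) ha.le hlam hlamα (sub_nonneg.2 hτ.2.le) i x

theorem exists_memMWith_heatSolution (hf : IsSource lam C l f) (hφ : MemMWith lam C l φ)
    (ha : 0 < a) (hlam : 0 ≤ lam) (hlamα : lam < α) (hT : 0 ≤ T) :
    ∃ C', ∀ t ∈ Icc 0 T, MemMWith lam C' l fun z => heatSolution a α φ f z t := by
  obtain ⟨M, hM0, hM⟩ := exists_memMWith_heatFlow p n ha hlam hlamα hT
  refine ⟨C * M + C * M * T, fun t ht => ⟨fun x => (hφ.constAt x).heatSolution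
    (fun τ hτ => (hf.memMWith τ hτ).constAt x) a α ht.1, fun x => ?_⟩⟩
  have hint : ‖∫ τ in (0 : ℝ)..t, heatFlow a α (t - τ) (fun z => f z τ) x‖ ≤
      C * M * (1 + ‖x‖ ^ lam) * |t - 0| :=
    intervalIntegral.norm_integral_le_of_norm_le_const fun τ hτ => by
      rw [uIoc_of_le ht.1] at hτ
      exact (hM (t - τ) ⟨sub_nonneg.2 hτ.2, by linarith [hτ.1, ht.2]⟩
        (hf.memMWith τ hτ.1)).norm_le x
  have hC := hφ.nonneg
  rw [sub_zero, abs_of_nonneg ht.1] at hint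
  refine (norm_add_le_of_le ((hM t ht hφ).norm_le x) hint).trans ?_
  rw [add_mul, mul_right_comm _ T]
  gcongr
  exact ht.2

theorem continuousOn_heatSolution (hf : IsSource lam C l f) (hφ : MemMWith lam C l φ)
    (ha : 0 < a) (hlam : 0 ≤ lam) (hlamα : lam < α) (hT : 0 ≤ T) (x : Fin n → ℚ_[p]) :
    ContinuousOn (heatSolution a α φ f x) (Icc 0 T) := by
  have hsum := summable_mul_eigenvalue_mul_mul_oscBound p hlam hlamα a (T * (1 + T)) C ‖x‖ (l x)
  have hdev := fun i => continuousOn_modeDev (a * eigenvalue p α i) (ballDiff i φ x)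
    (hf.intervalIntegrable_ballDiff hlam hT i x) hT
  refine ((continuousOn_mode 0 (φ x) (hf.intervalIntegrable hT x) hT).add
    (continuousOn_tsum hdev hsum fun i t ht => ?_)).congr
    fun t ht => hf.heatSolution_eq_tsum hφ ha hlam hlamα ht.1 x
  exact norm_modeDev_le (mul_nonneg ha.le (eigenvalue_pos α i).le) ht
    (hφ.norm_ballDiff_le hlam i x) (hf.norm_ballDiff_le hlam i x)

theorem hasDerivAt_tsum_modeDev (hf : IsSource lam C l f) (hφ : MemMWith lam C l φ)
    (ha : 0 ≤ a) (hlam : 0 ≤ lam) (hlamα : lam < α) (ht : 0 < t) (x : Fin n → ℚ_[p]) :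
    HasDerivAt (fun s => ∑' i, modeDev (a * eigenvalue p α i) (ballDiff i φ x)
        (fun τ => ballDiff i (fun z => f z τ) x) s)
      (∑' i, -((a * eigenvalue p α i) • mode (a * eigenvalue p α i) (ballDiff i φ x)
        (fun τ => ballDiff i (fun z => f z τ) x) t)) t := by
  have hk : ∀ i, 0 ≤ a * eigenvalue p α i := fun i => mul_nonneg ha (eigenvalue_pos α i).le
  have htmem : t ∈ Ioo 0 (t + 1) := ⟨ht, lt_add_one t⟩
  refine hasDerivAt_tsum_of_isPreconnected
    (summable_mul_eigenvalue_mul_mul_oscBound p hlam hlamα a (1 + (t + 1)) C ‖x‖ (l x))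
    isOpen_Ioo isPreconnected_Ioo
    (fun i s hs => hasDerivAt_modeDev _ _ hs.1 (hf.continuousOn_ballDiff i x)
      fun r hr => hf.intervalIntegrable_ballDiff hlam hr.le i x)
    (fun i s hs => ?_) htmem (.of_norm_bounded
      (summable_mul_eigenvalue_mul_mul_oscBound p hlam hlamα a (t * (1 + t)) C ‖x‖ (l x))
      fun i => norm_modeDev_le (hk i) ⟨ht.le, le_rfl⟩ (hφ.norm_ballDiff_le hlam i x)
        (hf.norm_ballDiff_le hlam i x)) htmem
  have hβ := (norm_nonneg _).trans (hφ.norm_ballDiff_le hlam i x)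
  rw [norm_neg, norm_smul, Real.norm_of_nonneg (hk i)]
  exact mul_le_mul_of_nonneg_left ((norm_mode_le (hk i) hs.1.le (hφ.norm_ballDiff_le hlam i x)
    (hf.norm_ballDiff_le hlam i x)).trans (mul_le_mul_of_nonneg_right (by linarith [hs.2]) hβ))
    (hk i)

theorem hasDerivAt_heatSolution (hf : IsSource lam C l f) (hφ : MemMWith lam C l φ)
    (ha : 0 < a) (hlam : 0 ≤ lam) (hlamα : lam < α) (ht : 0 < t) (x : Fin n → ℚ_[p]) :
    HasDerivAt (heatSolution a α φ f x)
      (f x t - a * taibleson α (fun z => heatSolution a α φ f z t) x) t := by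
  obtain ⟨C', hu⟩ := hf.exists_memMWith_heatSolution hφ ha hlam hlamα ht.le
  have hseries : heatSolution a α φ f x =ᶠ[𝓝 t] fun s => mode 0 (φ x) (f x) s +
      ∑' i, modeDev (a * eigenvalue p α i) (ballDiff i φ x)
        (fun τ => ballDiff i (fun z => f z τ) x) s :=
    eventually_of_mem (Ioi_mem_nhds ht) fun s hs =>
      hf.heatSolution_eq_tsum hφ ha hlam hlamα (mem_Ioi.1 hs).le x
  refine (((hasDerivAt_mode 0 (φ x) ht (hf.continuousOn x) (hf.intervalIntegrable ht.le x)).add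
    (hf.hasDerivAt_tsum_modeDev hφ ha.le hlam hlamα ht x)).congr_of_eventuallyEq
    hseries).congr_deriv ?_
  rw [taibleson_eq_tsum (hu t ⟨ht.le, le_rfl⟩) hlam hlamα, tsum_neg, zero_smul, sub_zero,
    ← sub_eq_add_neg, ← tsum_mul_left]
  simp only [hf.ballDiff_heatSolution hφ ha hlam hlamα ht.le, mul_smul, Complex.real_smul]

end IsSource

end Duhamel

section Cauchy

variable {a α lam C D t T : ℝ} {l m : (Fin n → ℚ_[p]) → ℤ} {φ : (Fin n → ℚ_[p]) → ℂ}
  {f F : (Fin n → ℚ_[p]) → ℝ → ℂ}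

theorem continuousOn_uncurry_of_constAt {X : Type*} [TopologicalSpace X] {S : Set X}
    {u : (Fin n → ℚ_[p]) → X → ℂ} (hl : ∀ t ∈ S, ∀ x, ConstAt (l x) (fun z => u z t) x)
    (hu : ∀ x, ContinuousOn (u x) S) : ContinuousOn (Function.uncurry u) (univ ×ˢ S) := by
  rintro ⟨x, t⟩ ⟨-, ht⟩
  have hslice : ContinuousWithinAt (fun q : (Fin n → ℚ_[p]) × X => u x q.2) (univ ×ˢ S) (x, t) :=
    (hu x t ht).comp continuous_snd.continuousWithinAt fun q hq => hq.2
  refine hslice.congr_of_eventuallyEq ?_ rfl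
  filter_upwards [self_mem_nhdsWithin, nhdsWithin_le_nhds
    (continuousAt_fst.eventually (eventually_sub_mem_padicBall x (l x)))] with q hqS hq
  simpa only [add_sub_cancel] using! constAt_iff.1 (hl q.2 hqS.2 x) _ hq

theorem MemMWith.mono (hφ : MemMWith lam C l φ) (hCD : C ≤ D) (hml : ∀ x, m x ≤ l x) :
    MemMWith lam D m φ where
  constAt x := (hφ.constAt x).mono (hml x)
  norm_le x := (hφ.norm_le x).trans (mul_le_mul_of_nonneg_right hCD (by positivity))

theorem exists_memMWith {S : Set ℝ} (hφ : MemM lam φ) (hf : UniformMemM lam S f) :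
    ∃ C l, MemMWith lam C l φ ∧ ∀ t ∈ S, MemMWith lam C l fun z => f z t := by
  obtain ⟨hφl, C, hφC⟩ := hφ
  obtain ⟨hfl, D, hfD⟩ := hf
  choose l hl using exists_constAt_of_isLocallyConstant hφl
  choose m hm using hfl
  exact ⟨max C D, fun x => min (l x) (m x),
    MemMWith.mono ⟨hl, hφC⟩ (le_max_left C D) fun x => min_le_left _ _,
    fun t ht => MemMWith.mono ⟨fun x => hm x t ht, hfD t ht⟩ (le_max_right C D)
      fun x => min_le_right _ _⟩

theorem uniformMemM_of_memMWith {S : Set ℝ} (hf : ∀ t ∈ S, MemMWith lam C l fun z => f z t) :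
    UniformMemM lam S f :=
  ⟨fun x => ⟨l x, fun t ht => (hf t ht).constAt x⟩, C, fun t ht => (hf t ht).norm_le⟩

theorem min_mem_Ioc (hT : 0 < T) (ht : 0 < t) : min t T ∈ Ioc 0 T :=
  ⟨lt_min ht hT, min_le_right t T⟩

theorem isSource_min (hT : 0 < T) (hf : ∀ t ∈ Ioc 0 T, MemMWith lam C l fun z => f z t)
    (hfc : ContinuousOn (Function.uncurry f) (univ ×ˢ Ioc 0 T)) :
    IsSource lam C l fun x t => f x (min t T) where
  memMWith t ht := hf _ (min_mem_Ioc hT ht)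
  continuousOn x := hfc.comp (f := fun t => (x, min t T)) (by fun_prop)
    fun t ht => ⟨mem_univ x, min_mem_Ioc hT ht⟩

namespace IsSource

theorem isCauchySolution (hF : IsSource lam C l F) (hφ : MemMWith lam C l φ) (ha : 0 < a)
    (hlam : 0 ≤ lam) (hlamα : lam < α) (hFf : ∀ t ∈ Ioc 0 T, ∀ x, F x t = f x t) :
    IsCauchySolution a α T f φ (heatSolution a α φ F) := by
  refine ⟨fun x t ht => ?_, heatSolution_zero a α φ F⟩
  obtain ⟨C', hu⟩ := hF.exists_memMWith_heatSolution hφ ha hlam hlamα ht.1.le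
  refine ⟨(integrable_and_hasSum_taiblesonIntegrand (hu t ⟨ht.1.le, le_rfl⟩) hlam hlamα x).1, _,
    (hF.hasDerivAt_heatSolution hφ ha hlam hlamα ht.1 x).hasDerivWithinAt, ?_⟩
  rw [sub_add_cancel, hFf t ht]

theorem heatSolution_eq_integral (hF : IsSource lam C l F) (hφ : MemMWith lam C l φ)
    (ha : 0 < a) (hlam : 0 ≤ lam) (hlamα : lam < α) (ht : 0 < t)
    (hFf : ∀ τ ∈ Ioo 0 t, ∀ x, F x τ = f x τ) (x : Fin n → ℚ_[p]) :
    Integrable (fun ξ => heatKernel a α (x - ξ) t * φ ξ) ∧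
      (∀ τ ∈ Ioo 0 t, Integrable fun ξ => heatKernel a α (x - ξ) (t - τ) * f ξ τ) ∧
      IntervalIntegrable (fun τ => ∫ ξ, heatKernel a α (x - ξ) (t - τ) * f ξ τ) volume 0 t ∧
      heatSolution a α φ F x t = (∫ ξ, heatKernel a α (x - ξ) t * φ ξ) +
        ∫ τ in (0 : ℝ)..t, ∫ ξ, heatKernel a α (x - ξ) (t - τ) * f ξ τ := by
  have hflow : ∀ τ ∈ uIoo 0 t, heatFlow a α (t - τ) (fun z => F z τ) x =
      ∫ ξ, heatKernel a α (x - ξ) (t - τ) * f ξ τ := fun τ hτ => by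
    rw [uIoo_of_le ht.le] at hτ
    simp only [← hFf τ hτ]
    exact (integral_heatKernel_mul (hF.memMWith τ hτ.1) ha hlam hlamα (sub_pos.2 hτ.2) x).symm
  refine ⟨(integrable_and_hasSum_heatKernel_mul ha hφ hlam hlamα ht x).1, fun τ hτ => ?_,
    (hF.intervalIntegrable_heatFlow ha hlam hlamα ht.le x).congr_uIoo hflow, ?_⟩
  · simp only [← hFf τ hτ]
    exact (integrable_and_hasSum_heatKernel_mul ha (hF.memMWith τ hτ.1) hlam hlamα
      (sub_pos.2 hτ.2) x).1
  · rw [heatSolution, integral_heatKernel_mul hφ ha hlam hlamα ht,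
      intervalIntegral.integral_congr_uIoo hflow]

end IsSource

end Cauchy

end

end PadicHeat

theorem theorem1 (p : ℕ) [Fact p.Prime] (n : ℕ) (hn : 0 < n) (a α lam T : ℝ)
    (ha : 0 < a) (hα : 0 < α) (hlam : 0 ≤ lam) (hlamα : lam < α) (hT : 0 < T)
    (φ : (Fin n → ℚ_[p]) → ℂ) (f : (Fin n → ℚ_[p]) → ℝ → ℂ)
    (hφ : PadicHeat.MemM lam φ)
    (hf : PadicHeat.UniformMemM lam (Set.Ioc 0 T) f)
    (hfc : ContinuousOn (Function.uncurry f) (Set.univ ×ˢ Set.Ioc 0 T)) :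
    ∃ u : (Fin n → ℚ_[p]) → ℝ → ℂ,
      ContinuousOn (Function.uncurry u) (Set.univ ×ˢ Set.Icc 0 T) ∧
      PadicHeat.UniformMemM lam (Set.Icc 0 T) u ∧
      (∀ l : ℤ, (∀ x, PadicHeat.ConstAt l φ x) →
        (∀ t ∈ Set.Ioc 0 T, ∀ x, PadicHeat.ConstAt l (fun z => f z t) x) →
        ∀ t ∈ Set.Icc 0 T, ∀ x, PadicHeat.ConstAt l (fun z => u z t) x) ∧
      PadicHeat.IsCauchySolution a α T f φ u ∧
      ∀ x, ∀ t ∈ Set.Ioc 0 T,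
        MeasureTheory.Integrable
          (fun ξ : Fin n → ℚ_[p] => PadicHeat.heatKernel a α (x - ξ) t * φ ξ) ∧
        (∀ τ ∈ Set.Ioo 0 t, MeasureTheory.Integrable
          (fun ξ : Fin n → ℚ_[p] => PadicHeat.heatKernel a α (x - ξ) (t - τ) * f ξ τ)) ∧
        IntervalIntegrable (fun τ : ℝ => ∫ ξ : Fin n → ℚ_[p],
          PadicHeat.heatKernel a α (x - ξ) (t - τ) * f ξ τ) MeasureTheory.volume 0 t ∧
        u x t = (∫ ξ : Fin n → ℚ_[p], PadicHeat.heatKernel a α (x - ξ) t * φ ξ) +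
          ∫ τ in (0 : ℝ)..t, ∫ ξ : Fin n → ℚ_[p],
            PadicHeat.heatKernel a α (x - ξ) (t - τ) * f ξ τ := by
  obtain ⟨C, l, hφl, hfl⟩ := PadicHeat.exists_memMWith hφ hf
  have hF := PadicHeat.isSource_min hT hfl hfc
  have hFf : ∀ t ∈ Set.Ioc 0 T, ∀ x, f x (min t T) = f x t := fun t ht x => by
    rw [min_eq_left ht.2]
  obtain ⟨C', hu⟩ := hF.exists_memMWith_heatSolution hφl ha hlam hlamα hT.le
  refine ⟨PadicHeat.heatSolution a α φ fun x t => f x (min t T), ?_,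
    PadicHeat.uniformMemM_of_memMWith hu, ?_,
    hF.isCauchySolution hφl ha hlam hlamα hFf, fun x t ht => ?_⟩
  · exact PadicHeat.continuousOn_uncurry_of_constAt (fun t ht => (hu t ht).constAt)
      (hF.continuousOn_heatSolution hφl ha hlam hlamα hT.le)
  · exact fun l hφconst hfconst t ht x => (hφconst x).heatSolution
      (fun τ hτ => hfconst _ (PadicHeat.min_mem_Ioc hT hτ) x) a α ht.1
  · exact hF.heatSolution_eq_integral hφl ha hlam hlamα ht.1
      (fun τ hτ => hFf τ ⟨hτ.1, hτ.2.le.trans ht.2⟩) x
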